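/- For a finite group $G$, let $\rho(G)$ be the probability that two elements $g,h\in G$, chosen independently and uniformly at random, have conjugates that commute (that is, there are a conjugate $g'$ of $g$ and a conjugate $h'$ of $h$ in $G$ with $g'h'=h'g'$). Let $S_n$ be the symmetric group of degree $n$, where $S_0$ is the trivial group, so that $\rho(S_0)=1$. Then the series $A_\rho=\sum_{n=0}^{\infty}\rho(S_n)$ converges, one has $$\rho(S_n)\sim\frac{A_\rho}{n^2}\qquad\text{as } n\to\infty,$$ and $6.1<A_\rho<6.5$. -/

import Mathlib

/-- Two elements `g`, `h` of a group have conjugates that commute. -/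
def HaveCommutingConjugates {G : Type*} [Group G] (g h : G) : Prop :=
  ∃ g' h' : G, IsConj g g' ∧ IsConj h h' ∧ Commute g' h'

/-- `rho G` is the probability that two elements of the finite group `G`, chosen independently
and uniformly at random, have conjugates that commute. -/
noncomputable def rho (G : Type*) [Group G] : ℝ :=
  (Nat.card {p : G × G // HaveCommutingConjugates p.1 p.2} : ℝ) / (Nat.card G : ℝ) ^ 2

/-- `rhoSymm n` is `rho` of the symmetric group of degree `n`
(for `n = 0` this is the trivial group, with value `1`). -/
noncomputable def rhoSymm (n : ℕ) : ℝ := rho (Equiv.Perm (Fin n))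

/-- The constant `∑ rho(S_n)`, the sum being over all degrees `n ≥ 0`. -/
noncomputable def Arho : ℝ := ∑' n : ℕ, rhoSymm n

/-!
Conjugacy in the symmetric group is decided by cycle types, so `rhoSymm n` is a sum over pairs of
cycle types `(s, t)` of degree `n` of the products `cycleWeight s * cycleWeight t` of class
densities, restricted to the pairs realised by commuting permutations. On a minimal set invariant
under two commuting permutations `g` and `h`, all cycles of `g` have one length `a`, all cycles of
`h` one length `b`, and the size is a multiple of `lcm a b`; conversely two translations of
`ZMod (lcm a b)` realise such a pair of lengths. Hence `(s, t)` is admissible exactly when it is a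
sum of *blocks* `(cycleBlock a b, cycleBlock b a)` (`haveCommutingConjugates_iff`).

Adding a block with cycle lengths `a` and `b` multiplies the weight of a pair by at most
`blockWeight a b`. Summed over all blocks of size `l` this gives
`sizeWeight l = 1 / l ^ 2 + O (1 / l ^ 3)`, the main contribution being `a = b = l`, where both
permutations have an `l`-cycle (`sizeWeight_le`). Writing `decompProb k n` for the part of
`rhoSymm n` that comes from blocks of size at most `k`, one gets the union bounds
`rhoSymm_le_decompProb_add` and `sum_decompProb_succ_le`. Since `decompProb k n` is at most the
square of the probability of having no cycle longer than `k`, it decays exponentially in `n`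
(`decompProb_le_exp`). As the tail of `∑ sizeWeight l` is eventually less than `1`, the series
converges.

In the other direction, cycles of the same length `n - m > n / 2` may be split off both permutations
without overcounting, so that `rhoSymm n ≥ ∑ rhoSymm m / (n - m) ^ 2` over `2 * m < n`
(`sum_rhoSymm_div_le`). Multiplied by `n ^ 2`, this lower bound tends to `∑ rhoSymm m` by dominated
convergence, and so does the matching part of the upper bound; the blocks of size between `k` and
`n / 2` contribute `O (1 / k)`, where `k` is arbitrary (`tendsto_sq_mul_rhoSymm`).

For the upper numerical bound, `∑ rhoSymm n` is at most `∑ decompProb 4 n` times the product of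
`1 / (1 - sizeWeight l)` over `4 < l ≤ 80`, times a tail factor (`sum_rhoSymm_le_const`). For the
lower one, the exact values of `rhoSymm m`, `m ≤ 10`, are inserted into the lower recursion
(`lt_Arho`). The finitely many values needed are computed by a search over partitions written as
lists of multiplicities, evaluated by the kernel.
-/

open Finset Function Filter Topology
open scoped Nat

/-! ### Cycle types of commuting permutations -/

/-- The multiset of cycle lengths that a block of size `lcm a b` contributes to the first of two
commuting permutations, when the first acts on the block with all cycles of length `a` and the
second with all cycles of length `b`. -/
def cycleBlock (a b : ℕ) : Multiset ℕ := Multiset.replicate (Nat.lcm a b / a) a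

/-- The pair `(s, t)` of multisets of cycle lengths is a sum of pairs
`(cycleBlock a b, cycleBlock b a)` with `0 < a`, `0 < b` and `lcm a b ≤ k`. -/
inductive BlockDecomp (k : ℕ) : Multiset ℕ → Multiset ℕ → Prop
  | zero : BlockDecomp k 0 0
  | add {s t : Multiset ℕ} (a b : ℕ) (ha : 0 < a) (hb : 0 < b) (hk : Nat.lcm a b ≤ k)
      (h : BlockDecomp k s t) : BlockDecomp k (cycleBlock a b + s) (cycleBlock b a + t)

theorem sum_cycleBlock (a b : ℕ) : (cycleBlock a b).sum = Nat.lcm a b := by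
  simp [cycleBlock, Nat.div_mul_cancel (Nat.dvd_lcm_left a b)]

namespace BlockDecomp

variable {k l : ℕ} {s t s' t' : Multiset ℕ}

theorem mono (hkl : k ≤ l) (h : BlockDecomp k s t) : BlockDecomp l s t := by
  induction h with
  | zero => exact .zero
  | add a b ha hb hk _ ih => exact .add a b ha hb (hk.trans hkl) ih

theorem append (h : BlockDecomp k s t) (h' : BlockDecomp k s' t') :
    BlockDecomp k (s + s') (t + t') := by
  induction h with
  | zero => simpa using h'
  | add a b ha hb hk _ ih => rw [add_assoc, add_assoc]; exact .add a b ha hb hk ih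

theorem nsmul_cycleBlock {a b : ℕ} (ha : 0 < a) (hb : 0 < b) (hk : Nat.lcm a b ≤ k) (m : ℕ) :
    BlockDecomp k (m • cycleBlock a b) (m • cycleBlock b a) := by
  induction m with
  | zero => simpa using BlockDecomp.zero
  | succ m ih => rw [succ_nsmul', succ_nsmul']; exact .add a b ha hb hk ih

theorem symm (h : BlockDecomp k s t) : BlockDecomp k t s := by
  induction h with
  | zero => exact .zero
  | add a b ha hb hk _ ih => exact .add b a hb ha (by rwa [Nat.lcm_comm]) ih

theorem pos_le_of_mem (h : BlockDecomp k s t) {i : ℕ} (hi : i ∈ s) : 0 < i ∧ i ≤ k := by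
  induction h with
  | zero => simp at hi
  | add a b ha hb hk _ ih =>
    rcases Multiset.mem_add.1 hi with hi | hi
    · rw [Multiset.eq_of_mem_replicate hi]
      exact ⟨ha, (Nat.le_of_dvd (Nat.lcm_pos ha hb) (Nat.dvd_lcm_left a b)).trans hk⟩
    · exact ih hi

theorem of_sum (h : BlockDecomp k s t) : BlockDecomp s.sum s t := by
  induction h with
  | zero => exact .zero
  | add a b ha hb hk _ ih =>
    rw [Multiset.sum_add, sum_cycleBlock]
    exact .add a b ha hb (Nat.le_add_right _ _) (ih.mono (Nat.le_add_left _ _))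

end BlockDecomp

theorem minimalPeriod_perm_pos {α : Type*} [Finite α] (g : Equiv.Perm α) (x : α) :
    0 < minimalPeriod g x :=
  minimalPeriod_pos_of_mem_periodicPts (g.injective.mem_periodicPts x)

theorem minimalPeriod_apply_of_commute {α : Type*} {g h : Equiv.Perm α} (hc : Commute g h) (x : α) :
    minimalPeriod g (h x) = minimalPeriod g x := by
  have hc' : ∀ n, g^[n] (h x) = h (g^[n] x) := by
    intro n
    have := DFunLike.congr_fun (hc.pow_left n).eq x
    simpa [Equiv.Perm.iterate_eq_pow] using this
  refine minimalPeriod_eq_minimalPeriod_iff.2 fun n => ?_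
  rw [IsPeriodicPt, IsPeriodicPt, IsFixedPt, IsFixedPt, hc', h.injective.eq_iff]

theorem minimalPeriod_eq_card_support_cycleOf {α : Type*} [Fintype α] [DecidableEq α] 
    (g : Equiv.Perm α) {x : α} (hx : g x ≠ x) :
    minimalPeriod g x = #(g.cycleOf x).support := by
  have hc := Equiv.Perm.isCycleOn_support_cycleOf g x
  have hm : x ∈ (g.cycleOf x).support := by
    rw [Equiv.Perm.mem_support_cycleOf_iff]
    exact ⟨Equiv.Perm.SameCycle.refl g x, Equiv.Perm.mem_support.2 hx⟩
  refine Nat.dvd_antisymm ?_ ?_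
  · refine IsPeriodicPt.minimalPeriod_dvd ?_
    have := (hc.pow_apply_eq hm).2 (dvd_refl _)
    rwa [← Equiv.Perm.iterate_eq_pow] at this
  · refine (hc.pow_apply_eq hm).1 ?_
    rw [← Equiv.Perm.iterate_eq_pow]
    exact iterate_minimalPeriod

/-- The points lying on cycles of length `d` number `d` times the multiplicity of `d` in the
cycle type (fixed points included). -/
theorem card_minimalPeriod_eq {α : Type*} [Fintype α] [DecidableEq α] (g : Equiv.Perm α) (d : ℕ) :
    #{x | minimalPeriod g x = d} = d * g.partition.parts.count d := by
  rw [Equiv.Perm.parts_partition]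
  rcases Nat.lt_or_ge d 2 with hd | hd
  · interval_cases d
    · simp [(minimalPeriod_perm_pos g _).ne']
    · rw [Multiset.count_add, Multiset.count_replicate_self,
        Multiset.count_eq_zero.2 fun h => by have := Equiv.Perm.two_le_of_mem_cycleType h; omega,
        zero_add, one_mul, ← Finset.card_compl]
      congr 1
      ext x
      simp [minimalPeriod_eq_one_iff_isFixedPt, IsFixedPt]
  · rw [Multiset.count_add, Multiset.count_replicate, if_neg (by omega), add_zero,
      Equiv.Perm.CycleType.count_def]
    have key : ({x | minimalPeriod g x = d} : Finset α) =
        (g.cycleFactorsFinset.filter fun c => #c.support = d).biUnion fun c => c.support := by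
      ext x
      simp only [mem_filter, mem_univ, true_and, mem_biUnion]
      constructor
      · intro h
        have hx : g x ≠ x := by
          intro hx
          have := minimalPeriod_eq_one_iff_isFixedPt.2 hx
          omega
        refine ⟨g.cycleOf x, ⟨?_, ?_⟩, ?_⟩
        · exact Equiv.Perm.cycleOf_mem_cycleFactorsFinset_iff.2 (Equiv.Perm.mem_support.2 hx)
        · rw [← minimalPeriod_eq_card_support_cycleOf g hx, h]
        · rw [Equiv.Perm.mem_support_cycleOf_iff]
          exact ⟨Equiv.Perm.SameCycle.refl g x, Equiv.Perm.mem_support.2 hx⟩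
      · rintro ⟨c, ⟨hc, hcd⟩, hx⟩
        have hce := Equiv.Perm.cycle_is_cycleOf hx hc
        have hgx : g x ≠ x := Equiv.Perm.mem_support.1
          (Equiv.Perm.mem_cycleFactorsFinset_support_le hc hx)
        rw [minimalPeriod_eq_card_support_cycleOf g hgx, ← hce, hcd]
    rw [key, Finset.card_biUnion]
    · rw [Finset.sum_congr rfl (fun c hc => (mem_filter.1 hc).2), Finset.sum_const, smul_eq_mul,
        mul_comm]
      congr 1
      rw [Fintype.card_subtype, ← Finset.card_map (Function.Embedding.subtype _)]
      congr 1
      ext c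
      simp [and_comm]
    · intro c hc c' hc' hne
      exact (Equiv.Perm.cycleFactorsFinset_pairwise_disjoint g (mem_filter.1 hc).1
        (mem_filter.1 hc').1 hne).disjoint_support

theorem parts_partition_eq_of_card {α : Type*} [Fintype α] [DecidableEq α] (g : Equiv.Perm α)
    {s : Multiset ℕ} (hs : ∀ i ∈ s, 0 < i)
    (h : ∀ d, #{x | minimalPeriod g x = d} = d * s.count d) : g.partition.parts = s := by
  ext d
  rcases Nat.eq_zero_or_pos d with rfl | hd
  · rw [Multiset.count_eq_zero.2, Multiset.count_eq_zero.2]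
    · exact fun h0 => (hs 0 h0).ne rfl
    · exact fun h0 => (g.partition.parts_pos h0).ne rfl
  · exact Nat.eq_of_mul_eq_mul_left hd (by rw [← h d, card_minimalPeriod_eq])

/-- If all points of a `g`-invariant set have the same period, that period divides the size of
the set. -/
theorem dvd_card_of_minimalPeriod_eq {α : Type*} [DecidableEq α] (g : Equiv.Perm α) {S : Finset α}
    (hS : ∀ x, g x ∈ S ↔ x ∈ S) {a : ℕ} (ha : ∀ x ∈ S, minimalPeriod g x = a) : a ∣ #S := by
  have h := card_minimalPeriod_eq (g.subtypePerm hS) a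
  have h1 : ∀ x : S, minimalPeriod (g.subtypePerm hS) x = a := by
    intro x
    rw [← ha x x.2]
    refine minimalPeriod_eq_minimalPeriod_iff.2 fun n => ?_
    rw [IsPeriodicPt, IsPeriodicPt, IsFixedPt, IsFixedPt, Equiv.Perm.iterate_eq_pow,
      Equiv.Perm.iterate_eq_pow, Equiv.Perm.subtypePerm_pow, Subtype.ext_iff,
      Equiv.Perm.subtypePerm_apply]
  rw [Finset.filter_true_of_mem (fun x _ => h1 x), Finset.card_univ] at h
  rw [← Fintype.card_coe]
  exact ⟨_, h⟩

/-- A minimal nonempty set invariant under two commuting permutations consists of points with the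
same period under either of them, so it is a multiple of a block; in general one splits the
invariant set into smaller ones. -/
theorem exists_blockDecomp_of_invariant {α : Type*} [Fintype α] [DecidableEq α] 
    {g h : Equiv.Perm α} (hc : Commute g h) (S : Finset α)
    (hg : ∀ x, g x ∈ S ↔ x ∈ S) (hh : ∀ x, h x ∈ S ↔ x ∈ S) :
    ∃ s t, BlockDecomp #S s t ∧ (∀ d, #{x ∈ S | minimalPeriod g x = d} = d * s.count d) ∧
      ∀ d, #{x ∈ S | minimalPeriod h x = d} = d * t.count d := by
  induction S using Finset.strongInduction with
  | H S ih =>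
    by_cases hsplit : ∃ T ⊂ S, T.Nonempty ∧ (∀ x, g x ∈ T ↔ x ∈ T) ∧ ∀ x, h x ∈ T ↔ x ∈ T
    · obtain ⟨T, hT, hne, hgT, hhT⟩ := hsplit
      obtain ⟨s, t, hd, hs, ht⟩ := ih T hT hgT hhT
      obtain ⟨s', t', hd', hs', ht'⟩ := ih (S \ T) (Finset.sdiff_ssubset hT.1 hne)
        (by intro x; simp [hg, hgT]) (by intro x; simp [hh, hhT])
      refine ⟨s + s', t + t', (hd.mono (card_le_card hT.1)).append
        (hd'.mono (card_le_card sdiff_subset)), fun d => ?_, fun d => ?_⟩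
      · rw [Multiset.count_add, mul_add, ← hs, ← hs', ← card_union_of_disjoint, ← filter_union,
          union_sdiff_of_subset hT.1]
        exact disjoint_filter_filter disjoint_sdiff
      · rw [Multiset.count_add, mul_add, ← ht, ← ht', ← card_union_of_disjoint, ← filter_union,
          union_sdiff_of_subset hT.1]
        exact disjoint_filter_filter disjoint_sdiff
    · rcases S.eq_empty_or_nonempty with rfl | ⟨x, hx⟩
      · exact ⟨0, 0, .zero, by simp, by simp⟩
      have hconst : ∀ f : Equiv.Perm α, Commute f g → Commute f h →
          ∀ y ∈ S, minimalPeriod f y = minimalPeriod f x := by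
        intro f hfg hfh
        by_contra hcon
        push Not at hcon
        obtain ⟨y, hy, hyx⟩ := hcon
        refine hsplit ⟨S.filter fun z => minimalPeriod f z = minimalPeriod f x, ?_, ⟨x, ?_⟩, ?_, ?_⟩
        · exact Finset.filter_ssubset.2 ⟨y, hy, hyx⟩
        · simp [hx]
        · intro z; simp [hg, minimalPeriod_apply_of_commute hfg]
        · intro z; simp [hh, minimalPeriod_apply_of_commute hfh]
      have hag := hconst g (Commute.refl g) hc
      have hbh := hconst h hc.symm (Commute.refl h)
      have hapos := minimalPeriod_perm_pos g x
      have hbpos := minimalPeriod_perm_pos h x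
      generalize minimalPeriod g x = a at *
      generalize minimalPeriod h x = b at *
      have hdvd : Nat.lcm a b ∣ #S := Nat.lcm_dvd (dvd_card_of_minimalPeriod_eq g hg hag)
        (dvd_card_of_minimalPeriod_eq h hh hbh)
      have hle := Nat.le_of_dvd (card_pos.2 ⟨x, hx⟩) hdvd
      obtain ⟨m, hm⟩ := hdvd
      refine ⟨_, _, BlockDecomp.nsmul_cycleBlock hapos hbpos hle m, fun d => ?_, fun d => ?_⟩
      · rw [Multiset.count_nsmul, cycleBlock, Multiset.count_replicate]
        split_ifs with had
        · rw [filter_true_of_mem (fun y hy => (hag y hy).trans had), hm, ← had,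
            mul_left_comm, Nat.mul_div_cancel' (Nat.dvd_lcm_left a b), mul_comm]
        · rw [filter_false_of_mem (fun y hy => by rw [hag y hy]; exact had)]; simp
      · rw [Multiset.count_nsmul, cycleBlock, Multiset.count_replicate]
        split_ifs with had
        · rw [filter_true_of_mem (fun y hy => (hbh y hy).trans had), hm, ← had,
            mul_left_comm, Nat.mul_div_cancel' (Nat.dvd_lcm_left b a), mul_comm, Nat.lcm_comm]
        · rw [filter_false_of_mem (fun y hy => by rw [hbh y hy]; exact had)]; simp

theorem blockDecomp_of_commute {α : Type*} [Fintype α] [DecidableEq α] {g h : Equiv.Perm α}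
    (hc : Commute g h) :
    BlockDecomp (Fintype.card α) g.partition.parts h.partition.parts := by
  obtain ⟨s, t, hd, hs, ht⟩ :=
    exists_blockDecomp_of_invariant hc Finset.univ (by simp) (by simp)
  rw [parts_partition_eq_of_card g (fun i hi => (hd.pos_le_of_mem hi).1) hs,
    parts_partition_eq_of_card h (fun i hi => (hd.symm.pos_le_of_mem hi).1) ht]
  exact hd

theorem minimalPeriod_addLeft_zmod {L : ℕ} (c : ZMod L) (x : ZMod L) :
    minimalPeriod (Equiv.addLeft c) x = addOrderOf c := by
  refine minimalPeriod_eq_minimalPeriod_iff.2 fun n => ?_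
  rw [IsPeriodicPt, IsPeriodicPt, IsFixedPt, IsFixedPt, Equiv.coe_addLeft, add_left_iterate]
  simp

theorem addOrderOf_div_zmod {L a : ℕ} [NeZero L] (ha : a ∣ L) :
    addOrderOf ((L / a : ℕ) : ZMod L) = a := by
  obtain ⟨c, rfl⟩ := ha
  have h0 : a * c ≠ 0 := NeZero.ne _
  have hac : 0 < a := Nat.pos_of_ne_zero (left_ne_zero_of_mul h0)
  have hcc : 0 < c := Nat.pos_of_ne_zero (right_ne_zero_of_mul h0)
  rw [Nat.mul_div_cancel_left _ hac, ZMod.addOrderOf_coe _ h0,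
    Nat.gcd_eq_right (Dvd.intro_left a rfl), Nat.mul_div_cancel _ hcc]

/-- A pair of cycle types with a block decomposition is realised by commuting permutations: a
block is realised by two translations of `ZMod (lcm a b)`. -/
theorem BlockDecomp.exists_commute {k : ℕ} {s t : Multiset ℕ} (hd : BlockDecomp k s t) :
    ∃ (α : Type) (_ : Fintype α) (_ : DecidableEq α) (g h : Equiv.Perm α), Commute g h ∧
      (∀ d, #{x | minimalPeriod g x = d} = d * s.count d) ∧
      ∀ d, #{x | minimalPeriod h x = d} = d * t.count d := by
  induction hd with
  | zero => exact ⟨Empty, inferInstance, inferInstance, 1, 1, Commute.one_left 1, by simp, by simp⟩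
  | @add s t a b ha hb hk _ ih =>
    obtain ⟨α, _, _, g, h, hc, hs, ht⟩ := ih
    have : NeZero (Nat.lcm a b) := ⟨(Nat.lcm_pos ha hb).ne'⟩
    let u : ZMod (Nat.lcm a b) := ((Nat.lcm a b / a : ℕ) : ZMod (Nat.lcm a b))
    let v : ZMod (Nat.lcm a b) := ((Nat.lcm a b / b : ℕ) : ZMod (Nat.lcm a b))
    have hsum : ∀ (c c' : ℕ) (w : ZMod (Nat.lcm a b)) (f : Equiv.Perm α) (r : Multiset ℕ),
        addOrderOf w = c → Nat.lcm c c' = Nat.lcm a b →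
        (∀ d, #{x | minimalPeriod f x = d} = d * r.count d) →
        ∀ d, #{x | minimalPeriod (Equiv.sumCongr (Equiv.addLeft w) f) x = d} =
          d * (cycleBlock c c' + r).count d := by
      intro c c' w f r hw hcc hr d
      have hl : ∀ x, minimalPeriod (Equiv.sumCongr (Equiv.addLeft w) f) (Sum.inl x) = c := by
        intro x
        rw [← hw, ← minimalPeriod_addLeft_zmod w x]
        refine minimalPeriod_eq_minimalPeriod_iff.2 fun n => ?_
        have : ∀ y, (Equiv.sumCongr (Equiv.addLeft w) f)^[n] (Sum.inl y) =
            Sum.inl ((Equiv.addLeft w)^[n] y) := by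
          induction n with
          | zero => simp
          | succ n ih => intro y; simp [iterate_succ_apply, ih]
        rw [IsPeriodicPt, IsPeriodicPt, IsFixedPt, IsFixedPt, this, Sum.inl_injective.eq_iff]
      have hr' : ∀ x, minimalPeriod (Equiv.sumCongr (Equiv.addLeft w) f) (Sum.inr x) =
          minimalPeriod f x := by
        intro x
        refine minimalPeriod_eq_minimalPeriod_iff.2 fun n => ?_
        have : ∀ y, (Equiv.sumCongr (Equiv.addLeft w) f)^[n] (Sum.inr y) =
            Sum.inr (f^[n] y) := by
          induction n with
          | zero => simp
          | succ n ih => intro y; simp [iterate_succ_apply, ih]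
        rw [IsPeriodicPt, IsPeriodicPt, IsFixedPt, IsFixedPt, this, Sum.inr_injective.eq_iff]
      rw [← Finset.univ_disjSum_univ, Finset.card_filter, Finset.sum_disjSum]
      simp only [hl, hr']
      rw [← Finset.card_filter, ← Finset.card_filter, hr, Multiset.count_add, mul_add, cycleBlock,
        Multiset.count_replicate]
      congr 1
      split_ifs with hcd
      · subst hcd
        simp [ZMod.card, hcc,
          Nat.mul_div_cancel' (show c ∣ Nat.lcm a b from hcc ▸ Nat.dvd_lcm_left c c')]
      · simp [hcd]
    refine ⟨ZMod (Nat.lcm a b) ⊕ α, inferInstance, inferInstance,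
      Equiv.sumCongr (Equiv.addLeft u) g, Equiv.sumCongr (Equiv.addLeft v) h, ?_, ?_, ?_⟩
    · show _ * _ = _ * _
      ext x
      rcases x with x | x
      · simpa using add_comm u v
      · simpa using DFunLike.congr_fun hc.eq x
    · exact hsum a b u g s (addOrderOf_div_zmod (Nat.dvd_lcm_left a b)) rfl hs
    · exact hsum b a v h t (addOrderOf_div_zmod (Nat.dvd_lcm_right a b)) (Nat.lcm_comm b a) ht

/-- Two permutations have commuting conjugates exactly when their cycle types have a common
block decomposition. -/
theorem haveCommutingConjugates_iff {n : ℕ} (g h : Equiv.Perm (Fin n)) :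
    HaveCommutingConjugates g h ↔ BlockDecomp n g.partition.parts h.partition.parts := by
  constructor
  · rintro ⟨g', h', hg, hh, hc⟩
    rw [Equiv.Perm.partition_eq_of_isConj.1 hg, Equiv.Perm.partition_eq_of_isConj.1 hh]
    simpa using blockDecomp_of_commute hc
  · intro hd
    obtain ⟨α, _, _, g', h', hc, hs, ht⟩ := hd.exists_commute
    have hs' := parts_partition_eq_of_card g' (fun i hi => (hd.pos_le_of_mem hi).1) hs
    have hcard : Fintype.card α = n := by
      rw [← g'.partition.parts_sum, hs', g.partition.parts_sum, Fintype.card_fin]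
    let e : α ≃ Fin n := Fintype.equivFinOfCardEq hcard
    have htrans : ∀ (f : Equiv.Perm α) (f' : Equiv.Perm (Fin n)),
        (∀ d, #{x | minimalPeriod f x = d} = d * f'.partition.parts.count d) →
        IsConj f' (e.permCongr f) := by
      intro f f' hf
      rw [Equiv.Perm.partition_eq_of_isConj, Nat.Partition.ext_iff, eq_comm]
      refine parts_partition_eq_of_card _ (fun i hi => f'.partition.parts_pos hi) fun d => ?_
      rw [← hf d]
      have hper : ∀ x, minimalPeriod (e.permCongr f) (e x) = minimalPeriod f x := fun x =>
        minimalPeriod_eq_minimalPeriod_iff.2 fun m => by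
          have hm : (e.permCongr f)^[m] (e x) = e (f^[m] x) :=
            ((show Semiconj e f (e.permCongr f) from fun y => by simp).iterate_right m x).symm
          rw [IsPeriodicPt, IsPeriodicPt, IsFixedPt, IsFixedPt, hm, e.injective.eq_iff]
      refine (Finset.card_bij (fun x _ => e x) ?_ (fun _ _ _ _ h => e.injective h) ?_).symm
      · intro x hx
        simpa [hper] using hx
      · intro y hy
        refine ⟨e.symm y, ?_, by simp⟩
        simpa [← hper] using hy
    exact ⟨_, _, htrans g' g hs, htrans h' h ht, by
      show _ * _ = _ * _
      ext x; have := DFunLike.congr_fun hc.eq (e.symm x); simp at this ⊢; rw [this]⟩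

/-! ### The probability as a sum over cycle types -/

/-- The proportion of permutations with cycle type `s` (fixed points counted as cycles of
length `1`) in the symmetric group of degree `s.sum`. -/
noncomputable def cycleWeight (s : Multiset ℕ) : ℝ :=
  ((s.prod : ℝ) * ∏ i ∈ s.toFinset, ((s.count i)! : ℝ))⁻¹

theorem cycleWeight_nonneg (s : Multiset ℕ) : 0 ≤ cycleWeight s := by
  unfold cycleWeight; positivity

/-- Adding `x` parts equal to `a` divides the weight by `a ^ x` and by the quotient
`(c + x)! / c!` of factorials, where `c` is the old multiplicity of `a`. -/
theorem cycleWeight_replicate_add (x a : ℕ) (s : Multiset ℕ) :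
    cycleWeight (Multiset.replicate x a + s) =
      cycleWeight s * ((s.count a)! / ((a : ℝ) ^ x * (x + s.count a)!)) := by
  have hprod : ∀ r : Multiset ℕ, ∀ u : Finset ℕ, r.toFinset ⊆ u →
      ∏ i ∈ r.toFinset, ((r.count i)! : ℝ) = ∏ i ∈ u, ((r.count i)! : ℝ) := by
    intro r u hu
    refine Finset.prod_subset hu fun i _ hi => ?_
    rw [Multiset.count_eq_zero.2 (by simpa using hi)]; simp
  set u := insert a (Multiset.replicate x a + s).toFinset with hu
  have h1 := hprod (Multiset.replicate x a + s) u (Finset.subset_insert _ _)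
  have h2 := hprod s u (by
    intro i hi
    simp only [hu, Finset.mem_insert, Multiset.mem_toFinset, Multiset.mem_add] at hi ⊢
    exact Or.inr (Or.inr hi))
  have ha : a ∈ u := Finset.mem_insert_self _ _
  have h3 : ∏ i ∈ u.erase a, (((Multiset.replicate x a + s).count i)! : ℝ) =
      ∏ i ∈ u.erase a, ((s.count i)! : ℝ) := by
    refine Finset.prod_congr rfl fun i hi => ?_
    rw [Multiset.count_add, Multiset.count_replicate, if_neg (Finset.ne_of_mem_erase hi).symm,
      zero_add]
  unfold cycleWeight
  rw [h1, h2, ← Finset.mul_prod_erase _ _ ha, ← Finset.mul_prod_erase _ _ ha, h3]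
  simp only [Multiset.prod_add, Multiset.prod_replicate, Multiset.count_add,
    Multiset.count_replicate_self, Nat.cast_mul, Nat.cast_pow]
  have : ((s.count a)! : ℝ) ≠ 0 := by positivity
  field_simp

theorem cycleWeight_replicate_add_le (x a : ℕ) (s : Multiset ℕ) :
    cycleWeight (Multiset.replicate x a + s) ≤ cycleWeight s * ((a : ℝ) ^ x * x !)⁻¹ := by
  rw [cycleWeight_replicate_add]
  refine mul_le_mul_of_nonneg_left ?_ (cycleWeight_nonneg s)
  rcases Nat.eq_zero_or_pos a with rfl | ha
  · rcases Nat.eq_zero_or_pos x with rfl | hx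
    · simp [div_self, Nat.factorial_ne_zero]
    · simp [hx.ne']
  rw [div_le_iff₀ (by positivity), ← div_eq_inv_mul, le_div_iff₀ (by positivity)]
  have h : x ! * (s.count a)! ≤ (x + s.count a)! :=
    Nat.le_of_dvd (Nat.factorial_pos _) (Nat.factorial_mul_factorial_dvd_factorial_add _ _)
  have h' : ((x ! : ℕ) : ℝ) * (s.count a)! ≤ (x + s.count a)! := by exact_mod_cast h
  have : (0 : ℝ) ≤ (a : ℝ) ^ x := by positivity
  nlinarith

theorem cycleWeight_replicate_add_of_notMem (x : ℕ) {a : ℕ} {s : Multiset ℕ} (h : a ∉ s) :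
    cycleWeight (Multiset.replicate x a + s) = cycleWeight s * ((a : ℝ) ^ x * x !)⁻¹ := by
  rw [cycleWeight_replicate_add, Multiset.count_eq_zero.2 h]; simp

/-- The cycle types of the symmetric group of degree `n`, as multisets. -/
def cycleTypes (n : ℕ) : Finset (Multiset ℕ) := univ.image (Nat.Partition.parts (n := n))

theorem mem_cycleTypes {n : ℕ} {s : Multiset ℕ} :
    s ∈ cycleTypes n ↔ s.sum = n ∧ ∀ i ∈ s, 0 < i := by
  simp only [cycleTypes, mem_image, mem_univ, true_and]
  constructor
  · rintro ⟨p, rfl⟩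
    exact ⟨p.parts_sum, fun i hi => p.parts_pos hi⟩
  · rintro ⟨hs, hpos⟩
    exact ⟨⟨s, fun {i} hi => hpos i hi, hs⟩, rfl⟩

theorem card_partition_parts_eq {n : ℕ} {s : Multiset ℕ} (hs : s ∈ cycleTypes n) :
    (#{g : Equiv.Perm (Fin n) | g.partition.parts = s} : ℝ) = n ! * cycleWeight s := by
  obtain ⟨hsum, hpos⟩ := mem_cycleTypes.1 hs
  -- split off the fixed points, which `Equiv.Perm.cycleType` ignores
  have hsplit : s = Multiset.replicate (s.count 1) 1 + s.filter (2 ≤ ·) := by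
    conv_lhs => rw [← Multiset.filter_add_not (· = 1) s]
    rw [Multiset.filter_eq']
    congr 1
    refine Multiset.filter_congr fun i hi => ?_
    have := hpos i hi
    omega
  set m := s.filter (2 ≤ ·) with hm
  have hm2 : ∀ i ∈ m, 2 ≤ i := fun i hi => (Multiset.mem_filter.1 hi).2
  have hn : s.count 1 + m.sum = n := by
    rw [← hsum]
    conv_rhs => rw [hsplit]
    simp
  have hset : ({g : Equiv.Perm (Fin n) | g.partition.parts = s} : Finset _) =
      ({g : Equiv.Perm (Fin n) | g.cycleType = m} : Finset _) := by
    ext g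
    simp only [mem_filter, mem_univ, true_and]
    constructor
    · intro h
      rw [← Equiv.Perm.filter_parts_partition_eq_cycleType, h]
    · intro h
      rw [Equiv.Perm.parts_partition, ← Equiv.Perm.sum_cycleType, h, Fintype.card_fin, add_comm]
      conv_rhs => rw [hsplit]
      congr 2
      omega
  have hcard := Equiv.Perm.card_of_cycleType_mul_eq (Fin n) m
  rw [if_pos ⟨by rw [Fintype.card_fin]; omega, hm2⟩, Fintype.card_fin] at hcard
  rw [hset]
  conv_rhs => rw [hsplit]
  rw [cycleWeight_replicate_add_of_notMem _ (fun h => by have := hm2 1 h; omega)]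
  rw [show n - m.sum = s.count 1 by omega] at hcard
  have hcard' : (#{g : Equiv.Perm (Fin n) | g.cycleType = m} : ℝ) *
      ((s.count 1)! * m.prod * ∏ i ∈ m.toFinset, ((m.count i)! : ℝ)) = n ! := by
    exact_mod_cast hcard
  have hm0 : (m.prod : ℝ) ≠ 0 := by
    rw [Nat.cast_ne_zero, Ne, Multiset.prod_eq_zero_iff]
    intro h; have := hm2 0 h; omega
  have hp0 : (∏ i ∈ m.toFinset, ((m.count i)! : ℝ)) ≠ 0 := by positivity
  have hc0 : ((s.count 1)! : ℝ) ≠ 0 := by positivity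
  unfold cycleWeight
  rw [← hcard', Nat.cast_one, one_pow, one_mul]
  clear hsplit
  field_simp

open Classical in
/-- The proportion of pairs of permutations of degree `n` whose cycle types have a common
decomposition into blocks of size at most `k`. -/
noncomputable def decompProb (k n : ℕ) : ℝ :=
  ∑ p ∈ (cycleTypes n ×ˢ cycleTypes n).filter (fun p => BlockDecomp k p.1 p.2),
    cycleWeight p.1 * cycleWeight p.2

theorem rhoSymm_eq_decompProb (n : ℕ) : rhoSymm n = decompProb n n := by
  classical
  have hG : (Nat.card (Equiv.Perm (Fin n)) : ℝ) = n ! := by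
    simp [Nat.card_eq_fintype_card, Fintype.card_perm]
  have hcount : Nat.card {p : Equiv.Perm (Fin n) × Equiv.Perm (Fin n) //
      HaveCommutingConjugates p.1 p.2} = #((univ : Finset (Equiv.Perm (Fin n) ×
        Equiv.Perm (Fin n))).filter fun p => HaveCommutingConjugates p.1 p.2) := by
    rw [Nat.card_eq_fintype_card, Fintype.card_subtype]
  unfold rhoSymm rho decompProb
  rw [hG, hcount, Finset.card_eq_sum_card_fiberwise
    (f := fun p => (p.1.partition.parts, p.2.partition.parts))
    (t := (cycleTypes n ×ˢ cycleTypes n).filter (fun p => BlockDecomp n p.1 p.2))]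
  · rw [Nat.cast_sum, Finset.sum_div]
    refine Finset.sum_congr rfl fun p hp => ?_
    obtain ⟨hp1, hp2⟩ := mem_filter.1 hp
    obtain ⟨h1, h2⟩ := mem_product.1 hp1
    have : ((univ : Finset (Equiv.Perm (Fin n) × Equiv.Perm (Fin n))).filter
        (fun q => HaveCommutingConjugates q.1 q.2)).filter
        (fun q => (q.1.partition.parts, q.2.partition.parts) = p) =
        ({g : Equiv.Perm (Fin n) | g.partition.parts = p.1} : Finset _) ×ˢ
        ({g : Equiv.Perm (Fin n) | g.partition.parts = p.2} : Finset _) := by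
      ext q
      simp only [mem_filter, mem_univ, true_and, mem_product, Prod.ext_iff,
        haveCommutingConjugates_iff]
      constructor
      · exact fun h => h.2
      · rintro ⟨h1, h2⟩
        exact ⟨by rw [h1, h2]; exact hp2, h1, h2⟩
    rw [this, card_product, Nat.cast_mul, card_partition_parts_eq h1, card_partition_parts_eq h2]
    have : (n ! : ℝ) ≠ 0 := by positivity
    field_simp
  · intro p hp
    have hp' : HaveCommutingConjugates p.1 p.2 := by simpa using hp
    have hmem : ∀ g : Equiv.Perm (Fin n), g.partition.parts ∈ cycleTypes n := fun g =>
      mem_cycleTypes.2 ⟨g.partition.parts_sum.trans (Fintype.card_fin n),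
        fun i hi => g.partition.parts_pos hi⟩
    simp only [coe_filter, mem_product, Set.mem_ofPred_eq]
    exact ⟨⟨hmem _, hmem _⟩, (haveCommutingConjugates_iff _ _).1 hp'⟩

/-! ### Removing and adding blocks -/

theorem BlockDecomp.succ_cases {k : ℕ} {s t : Multiset ℕ} (h : BlockDecomp (k + 1) s t) :
    BlockDecomp k s t ∨ ∃ a b s' t', 0 < a ∧ 0 < b ∧ Nat.lcm a b = k + 1 ∧
      BlockDecomp (k + 1) s' t' ∧ s = cycleBlock a b + s' ∧ t = cycleBlock b a + t' := by
  induction h with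
  | zero => exact Or.inl .zero
  | @add s t a b ha hb hk h ih =>
    rcases hk.eq_or_lt with hk | hk
    · exact Or.inr ⟨a, b, s, t, ha, hb, hk, h, rfl, rfl⟩
    · rcases ih with ih | ⟨a', b', s', t', ha', hb', hk', h', rfl, rfl⟩
      · exact Or.inl (.add a b ha hb (Nat.le_of_lt_succ hk) ih)
      · exact Or.inr ⟨a', b', _, _, ha', hb', hk', .add a b ha hb hk.le h',
          add_left_comm _ _ _, add_left_comm _ _ _⟩

theorem sum_le_sum_add_of_cover {ι κ : Type*} [DecidableEq ι] (F A : Finset ι)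
    (B : Finset κ) (e : κ → ι) {f : ι → ℝ} (hf : ∀ i, 0 ≤ f i)
    (h : ∀ p ∈ F, p ∈ A ∨ ∃ q ∈ B, e q = p) :
    ∑ p ∈ F, f p ≤ ∑ p ∈ A, f p + ∑ q ∈ B, f (e q) := by
  have h1 : ∑ p ∈ F, f p ≤ ∑ p ∈ A ∪ B.image e, f p :=
    Finset.sum_le_sum_of_subset_of_nonneg
      (fun p hp => by simpa [mem_union, mem_image] using h p hp) fun i _ _ => hf i
  have h2 := Finset.sum_union_inter (s₁ := A) (s₂ := B.image e) (f := f)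
  have h3 : 0 ≤ ∑ p ∈ A ∩ B.image e, f p := Finset.sum_nonneg fun i _ => hf i
  have h4 : ∑ p ∈ B.image e, f p ≤ ∑ q ∈ B, f (e q) :=
    Finset.sum_image_le_of_nonneg fun i _ => hf i
  linarith

/-- The factor by which the weight of a pair of cycle types drops, at least, when a block with
cycle lengths `a` and `b` is added. -/
noncomputable def blockWeight (a b : ℕ) : ℝ :=
  ((a : ℝ) ^ (Nat.lcm a b / a) * (Nat.lcm a b / a)!)⁻¹ *
    ((b : ℝ) ^ (Nat.lcm b a / b) * (Nat.lcm b a / b)!)⁻¹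

/-- The pairs of cycle lengths of the blocks of size `l`. -/
def blockPairs (l : ℕ) : Finset (ℕ × ℕ) :=
  (l.divisors ×ˢ l.divisors).filter fun p => Nat.lcm p.1 p.2 = l

/-- The total weight of the blocks of size `l`. -/
noncomputable def sizeWeight (l : ℕ) : ℝ := ∑ p ∈ blockPairs l, blockWeight p.1 p.2

theorem blockWeight_nonneg (a b : ℕ) : 0 ≤ blockWeight a b := by unfold blockWeight; positivity

theorem sizeWeight_nonneg (l : ℕ) : 0 ≤ sizeWeight l :=
  Finset.sum_nonneg fun _ _ => blockWeight_nonneg _ _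

theorem decompProb_nonneg (k n : ℕ) : 0 ≤ decompProb k n :=
  Finset.sum_nonneg fun _ _ => mul_nonneg (cycleWeight_nonneg _) (cycleWeight_nonneg _)

theorem decompProb_le_rhoSymm (k n : ℕ) : decompProb k n ≤ rhoSymm n := by
  classical
  rw [rhoSymm_eq_decompProb]
  refine Finset.sum_le_sum_of_subset_of_nonneg (fun p hp => ?_)
    fun _ _ _ => mul_nonneg (cycleWeight_nonneg _) (cycleWeight_nonneg _)
  obtain ⟨hp1, hp2⟩ := mem_filter.1 hp
  have := hp2.of_sum
  rw [(mem_cycleTypes.1 (mem_product.1 hp1).1).1] at this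
  exact mem_filter.2 ⟨hp1, this⟩

theorem decompProb_eq_rhoSymm {k n : ℕ} (h : n ≤ k) : decompProb k n = rhoSymm n := by
  classical
  refine le_antisymm (decompProb_le_rhoSymm k n) ?_
  rw [rhoSymm_eq_decompProb]
  refine Finset.sum_le_sum_of_subset_of_nonneg (fun p hp => ?_)
    fun _ _ _ => mul_nonneg (cycleWeight_nonneg _) (cycleWeight_nonneg _)
  obtain ⟨hp1, hp2⟩ := mem_filter.1 hp
  exact mem_filter.2 ⟨hp1, hp2.mono h⟩

theorem rhoSymm_nonneg (n : ℕ) : 0 ≤ rhoSymm n := by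
  rw [rhoSymm_eq_decompProb]; exact decompProb_nonneg n n

/-- A pair decomposable into blocks of size at most `k + 1` either uses only blocks of size at
most `k`, or has a block of size `k + 1` that can be removed. -/
theorem decompProb_succ_le (k n : ℕ) :
    decompProb (k + 1) n ≤ decompProb k n +
      if k + 1 ≤ n then sizeWeight (k + 1) * decompProb (k + 1) (n - (k + 1)) else 0 := by
  classical
  have hnn : ∀ p : Multiset ℕ × Multiset ℕ, 0 ≤ cycleWeight p.1 * cycleWeight p.2 :=
    fun p => mul_nonneg (cycleWeight_nonneg _) (cycleWeight_nonneg _)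
  have hmem : ∀ a b s t, Nat.lcm a b = k + 1 → s = cycleBlock a b + t →
      s ∈ cycleTypes n → k + 1 ≤ n ∧ t ∈ cycleTypes (n - (k + 1)) := by
    rintro a b s t hab rfl hs
    rw [mem_cycleTypes, Multiset.sum_add, sum_cycleBlock, hab] at hs
    refine ⟨by omega, mem_cycleTypes.2 ⟨by omega, fun i hi => hs.2 i ?_⟩⟩
    exact Multiset.mem_add.2 (Or.inr hi)
  have hcov : ∀ p ∈ (cycleTypes n ×ˢ cycleTypes n).filter (fun p => BlockDecomp (k + 1) p.1 p.2),
      p ∈ (cycleTypes n ×ˢ cycleTypes n).filter (fun p => BlockDecomp k p.1 p.2) ∨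
      (k + 1 ≤ n ∧ ∃ q ∈ blockPairs (k + 1) ×ˢ
        (cycleTypes (n - (k + 1)) ×ˢ cycleTypes (n - (k + 1))).filter
          (fun p => BlockDecomp (k + 1) p.1 p.2),
        (cycleBlock q.1.1 q.1.2 + q.2.1, cycleBlock q.1.2 q.1.1 + q.2.2) = p) := by
    rintro ⟨s, t⟩ hp
    obtain ⟨hp1, hp2⟩ := mem_filter.1 hp
    obtain ⟨hs, ht⟩ := mem_product.1 hp1
    rcases hp2.succ_cases with h | ⟨a, b, s', t', ha, hb, hab, h, rfl, rfl⟩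
    · exact Or.inl (mem_filter.2 ⟨hp1, h⟩)
    · obtain ⟨hkn, hs'⟩ := hmem a b _ s' hab rfl hs
      obtain ⟨-, ht'⟩ := hmem b a _ t' (by rw [Nat.lcm_comm, hab]) rfl ht
      refine Or.inr ⟨hkn, ⟨(a, b), (s', t')⟩, ?_, rfl⟩
      simp only [mem_product, mem_filter, blockPairs, Nat.mem_divisors]
      exact ⟨⟨⟨⟨hab ▸ Nat.dvd_lcm_left a b, by omega⟩, hab ▸ Nat.dvd_lcm_right a b, by omega⟩, hab⟩,
        ⟨hs', ht'⟩, h⟩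
  split_ifs with hkn
  · refine (sum_le_sum_add_of_cover _ _ _ _ hnn
      fun p hp => (hcov p hp).imp_right fun h => h.2).trans
      (add_le_add le_rfl ?_)
    rw [sizeWeight, decompProb, Finset.sum_mul_sum, ← Finset.sum_product']
    refine Finset.sum_le_sum fun q _ => ?_
    calc _ ≤ (cycleWeight q.2.1 * _) * (cycleWeight q.2.2 * _) :=
          mul_le_mul (cycleWeight_replicate_add_le _ _ _) (cycleWeight_replicate_add_le _ _ _)
            (cycleWeight_nonneg _) (by have := cycleWeight_nonneg q.2.1; positivity)
      _ = _ := by unfold blockWeight; ring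
  · rw [add_zero]
    exact Finset.sum_le_sum_of_subset_of_nonneg
      (fun p hp => (hcov p hp).resolve_right fun h => hkn h.1) fun _ _ _ => hnn _

/-- Iterating `decompProb_succ_le`: remove the largest block, as long as its size exceeds `k`. -/
theorem rhoSymm_le_decompProb_add (k n : ℕ) :
    rhoSymm n ≤ decompProb k n + ∑ j ∈ Ioc k n, sizeWeight j * rhoSymm (n - j) := by
  have key : ∀ m, k ≤ m → m ≤ n →
      decompProb m n ≤ decompProb k n + ∑ j ∈ Ioc k m, sizeWeight j * rhoSymm (n - j) := by
    intro m hm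
    induction m, hm using Nat.le_induction with
    | base => simp
    | succ m hkm ih =>
      intro hmn
      have h := decompProb_succ_le m n
      rw [if_pos hmn] at h
      rw [← Finset.insert_Ioc_right_eq_Ioc_add_one hkm, Finset.sum_insert (by simp)]
      have h2 := mul_le_mul_of_nonneg_left (decompProb_le_rhoSymm (m + 1) (n - (m + 1)))
        (sizeWeight_nonneg (m + 1))
      have := ih (by omega)
      linarith
  rcases le_total k n with h | h
  · rw [rhoSymm_eq_decompProb]; exact key n h le_rfl
  · rw [decompProb_eq_rhoSymm h]
    have : 0 ≤ ∑ j ∈ Ioc k n, sizeWeight j * rhoSymm (n - j) :=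
      Finset.sum_nonneg fun j _ => mul_nonneg (sizeWeight_nonneg _) (rhoSymm_nonneg _)
    linarith

/-- Summed over degrees: allowing blocks of size `k + 1` costs a factor `1 / (1 - sizeWeight)`. -/
theorem sum_decompProb_succ_le (k N : ℕ) :
    (1 - sizeWeight (k + 1)) * ∑ n ∈ range N, decompProb (k + 1) n ≤
      ∑ n ∈ range N, decompProb k n := by
  have h := Finset.sum_le_sum fun n (_ : n ∈ range N) => decompProb_succ_le k n
  rw [Finset.sum_add_distrib, ← Finset.sum_filter, ← Finset.mul_sum] at h
  have h2 : ∑ n ∈ range N with k + 1 ≤ n, decompProb (k + 1) (n - (k + 1)) ≤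
      ∑ n ∈ range N, decompProb (k + 1) n := by
    rw [← Finset.sum_image (g := fun n => n - (k + 1)) (f := decompProb (k + 1))]
    · refine Finset.sum_le_sum_of_subset_of_nonneg (fun i hi => ?_)
        fun _ _ _ => decompProb_nonneg _ _
      simp only [mem_image, mem_filter, mem_range] at hi ⊢
      obtain ⟨n, hn, rfl⟩ := hi
      omega
    · intro a ha b hb hab
      simp only [coe_filter, mem_range, Set.mem_ofPred_eq] at ha hb hab
      omega
  have := mul_le_mul_of_nonneg_left h2 (sizeWeight_nonneg (k + 1))
  linarith

/-- Summed over degrees, with all blocks larger than `k` removed at once. -/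
theorem sum_rhoSymm_le (k N : ℕ) :
    (1 - ∑ j ∈ Ioc k N, sizeWeight j) * ∑ n ∈ range N, rhoSymm n ≤
      ∑ n ∈ range N, decompProb k n := by
  have h := Finset.sum_le_sum fun n (_ : n ∈ range N) => rhoSymm_le_decompProb_add k n
  rw [Finset.sum_add_distrib] at h
  have h2 : ∑ n ∈ range N, ∑ j ∈ Ioc k n, sizeWeight j * rhoSymm (n - j) ≤
      (∑ j ∈ Ioc k N, sizeWeight j) * ∑ n ∈ range N, rhoSymm n := by
    rw [Finset.sum_mul_sum, Finset.sum_sigma', ← Finset.sum_product']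
    have hinj : ∀ a ∈ (range N).sigma (fun n => Ioc k n), ∀ b ∈ (range N).sigma fun n => Ioc k n,
        ((a.2, a.1 - a.2) : ℕ × ℕ) = (b.2, b.1 - b.2) → a = b := by
      rintro ⟨n, j⟩ ha ⟨n', j'⟩ hb hab
      simp only [mem_sigma, mem_range, mem_Ioc, Prod.mk.injEq] at ha hb hab
      obtain ⟨rfl, hab⟩ := hab
      have : n = n' := by omega
      subst this; rfl
    rw [← Finset.sum_image (g := fun a : (_ : ℕ) × ℕ => (a.2, a.1 - a.2))
      (f := fun q : ℕ × ℕ => sizeWeight q.1 * rhoSymm q.2) hinj]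
    refine Finset.sum_le_sum_of_subset_of_nonneg (fun q hq => ?_)
      fun _ _ _ => mul_nonneg (sizeWeight_nonneg _) (rhoSymm_nonneg _)
    simp only [mem_image, mem_sigma, mem_range, mem_Ioc, mem_product] at hq ⊢
    obtain ⟨a, ha, rfl⟩ := hq
    dsimp only
    omega
  linarith

/-- If both permutations of degree `n` have a cycle of the same length `n - m > n / 2`, they have
commuting conjugates as soon as the induced permutations on the remaining points do. -/
theorem sum_rhoSymm_div_le (n : ℕ) :
    ∑ m ∈ range n with 2 * m < n, rhoSymm m / ((n : ℝ) - m) ^ 2 ≤ rhoSymm n := by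
  classical
  obtain ⟨F, hFdef⟩ : ∃ F : ℕ → Finset (Multiset ℕ × Multiset ℕ), ∀ m, F m =
      (cycleTypes m ×ˢ cycleTypes m).filter (fun p => BlockDecomp m p.1 p.2) := ⟨_, fun _ => rfl⟩
  have hF : ∀ {m s t}, (s, t) ∈ F m → s ∈ cycleTypes m ∧ t ∈ cycleTypes m ∧ BlockDecomp m s t := by
    intro m s t h
    rw [hFdef] at h
    obtain ⟨h1, h2⟩ := mem_filter.1 h
    exact ⟨(mem_product.1 h1).1, (mem_product.1 h1).2, h2⟩
  have hnot : ∀ {m s}, s ∈ cycleTypes m → ∀ i ∈ s, i ≤ m := by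
    intro m s hs i hi
    rw [← (mem_cycleTypes.1 hs).1]
    exact Multiset.le_sum_of_mem hi
  obtain ⟨addCycle, hadd⟩ : ∃ f : (_ : ℕ) × (Multiset ℕ × Multiset ℕ) → Multiset ℕ × Multiset ℕ,
      ∀ m s t, f ⟨m, s, t⟩ =
        (Multiset.replicate 1 (n - m) + s, Multiset.replicate 1 (n - m) + t) :=
    ⟨fun q => (Multiset.replicate 1 (n - q.1) + q.2.1, Multiset.replicate 1 (n - q.1) + q.2.2),
      fun _ _ _ => rfl⟩
  have hinj : ∀ a ∈ ((range n).filter fun m => 2 * m < n).sigma F,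
      ∀ b ∈ ((range n).filter fun m => 2 * m < n).sigma F, addCycle a = addCycle b → a = b := by
    rintro ⟨m, s, t⟩ ha ⟨m', s', t'⟩ hb hab
    simp only [mem_sigma, mem_filter, mem_range] at ha hb
    simp only [hadd, Prod.mk.injEq] at hab
    have hm : m = m' := by
      by_contra hne
      have h1 : n - m' ∈ Multiset.replicate 1 (n - m) + s := by rw [hab.1]; simp
      rcases Multiset.mem_add.1 h1 with h1 | h1
      · have := Multiset.eq_of_mem_replicate h1; omega
      · have := hnot (hF ha.2).1 _ h1; omega
    subst hm
    rw [add_right_inj, add_right_inj] at hab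
    rw [hab.1, hab.2]
  have hterm : ∀ m ∈ (range n).filter fun m => 2 * m < n, rhoSymm m / ((n : ℝ) - m) ^ 2 =
      ∑ p ∈ F m, cycleWeight (addCycle ⟨m, p⟩).1 * cycleWeight (addCycle ⟨m, p⟩).2 := by
    intro m hm
    have hm2 : 2 * m < n := (mem_filter.1 hm).2
    rw [rhoSymm_eq_decompProb, decompProb, ← hFdef, Finset.sum_div]
    refine Finset.sum_congr rfl ?_
    rintro ⟨s, t⟩ hst
    obtain ⟨hs', ht', -⟩ := hF hst
    have hs : n - m ∉ s := fun h => by have := hnot hs' _ h; omega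
    have ht : n - m ∉ t := fun h => by have := hnot ht' _ h; omega
    rw [hadd, cycleWeight_replicate_add_of_notMem 1 hs, cycleWeight_replicate_add_of_notMem 1 ht,
      Nat.cast_sub (by omega)]
    simp only [pow_one, Nat.factorial_one, Nat.cast_one, mul_one]
    rw [div_eq_mul_inv, sq, mul_inv]
    ring
  rw [Finset.sum_congr rfl hterm, Finset.sum_sigma', rhoSymm_eq_decompProb, decompProb, ← hFdef,
    ← Finset.sum_image (f := fun p => cycleWeight p.1 * cycleWeight p.2) hinj]
  refine Finset.sum_le_sum_of_subset_of_nonneg ?_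
    fun _ _ _ => mul_nonneg (cycleWeight_nonneg _) (cycleWeight_nonneg _)
  intro p hp
  obtain ⟨⟨m, s, t⟩, hq, rfl⟩ := mem_image.1 hp
  obtain ⟨hm, hst⟩ := mem_sigma.1 hq
  have hm2 : 2 * m < n := (mem_filter.1 hm).2
  obtain ⟨hs, ht, hd⟩ := hF hst
  rw [hadd, hFdef]
  have hcyc : ∀ {s}, s ∈ cycleTypes m → Multiset.replicate 1 (n - m) + s ∈ cycleTypes n := by
    intro s hs
    obtain ⟨h1, h2⟩ := mem_cycleTypes.1 hs
    refine mem_cycleTypes.2 ⟨?_, fun i hi => ?_⟩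
    · rw [Multiset.sum_add, Multiset.sum_replicate, h1, one_smul]
      omega
    · rcases Multiset.mem_add.1 hi with h | h
      · rw [Multiset.eq_of_mem_replicate h]; omega
      · exact h2 i h
  refine mem_filter.2 ⟨mem_product.2 ⟨hcyc hs, hcyc ht⟩, ?_⟩
  have hb : cycleBlock (n - m) (n - m) = Multiset.replicate 1 (n - m) := by
    rw [cycleBlock, Nat.lcm_self, Nat.div_self (by omega)]
  have := BlockDecomp.add (n - m) (n - m) (by omega) (by omega)
    (by rw [Nat.lcm_self]; omega) (hd.mono (show m ≤ n by omega))
  rwa [hb] at this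

/-! ### Permutations without long cycles and the weight of blocks of a given size -/

/-- The cycle types of the symmetric group of degree `n` with all cycle lengths at most `k`. -/
def boundedTypes (k n : ℕ) : Finset (Multiset ℕ) := (cycleTypes n).filter fun s => ∀ i ∈ s, i ≤ k

theorem mem_boundedTypes {k n : ℕ} {s : Multiset ℕ} :
    s ∈ boundedTypes k n ↔ s.sum = n ∧ ∀ i ∈ s, 0 < i ∧ i ≤ k := by
  simp only [boundedTypes, mem_filter, mem_cycleTypes, and_assoc, forall_and]

theorem boundedTypes_zero (n : ℕ) : boundedTypes 0 n = if n = 0 then {0} else ∅ := by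
  ext s
  rw [mem_boundedTypes]
  constructor
  · rintro ⟨h, hs⟩
    have : s = 0 := Multiset.eq_zero_of_forall_notMem fun i hi => by have := hs i hi; omega
    subst this
    simp [← h]
  · split_ifs with h
    · intro hs
      rw [mem_singleton] at hs
      subst hs
      simp [h]
    · simp

/-- Summing over the multiplicity `x` of the largest admissible part `k + 1`. -/
theorem sum_boundedTypes_succ {M : Type*} [AddCommMonoid M] (f : Multiset ℕ → M) (k n : ℕ) :
    ∑ s ∈ boundedTypes (k + 1) n, f s = ∑ x ∈ range (n / (k + 1) + 1),
      ∑ s ∈ boundedTypes k (n - x * (k + 1)), f (Multiset.replicate x (k + 1) + s) := by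
  have hsplit : ∀ s : Multiset ℕ,
      Multiset.replicate (s.count (k + 1)) (k + 1) + s.filter (· ≠ k + 1) = s := by
    intro s
    conv_rhs => rw [← Multiset.filter_add_not (· = k + 1) s]
    rw [Multiset.filter_eq']
  rw [Finset.sum_sigma']
  refine Finset.sum_bij' (fun s _ => ⟨s.count (k + 1), s.filter (· ≠ k + 1)⟩)
    (fun q _ => Multiset.replicate q.1 (k + 1) + q.2) ?_ ?_ ?_ ?_ ?_
  · intro s hs
    rw [mem_boundedTypes] at hs
    have h1 := hs.1
    rw [← hsplit s, Multiset.sum_add, Multiset.sum_replicate, smul_eq_mul] at h1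
    rw [mem_sigma, mem_range, mem_boundedTypes, Nat.lt_succ_iff, Nat.le_div_iff_mul_le (by omega)]
    dsimp only
    refine ⟨by omega, by omega, fun i hi => ?_⟩
    obtain ⟨hi1, hi2⟩ := Multiset.mem_filter.1 hi
    have := hs.2 i hi1
    omega
  · rintro ⟨x, s⟩ hq
    rw [mem_sigma, mem_range, mem_boundedTypes, Nat.lt_succ_iff,
      Nat.le_div_iff_mul_le (by omega)] at hq
    dsimp only at hq ⊢
    rw [mem_boundedTypes, Multiset.sum_add, Multiset.sum_replicate, smul_eq_mul]
    refine ⟨by omega, fun i hi => ?_⟩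
    rcases Multiset.mem_add.1 hi with hi | hi
    · rw [Multiset.eq_of_mem_replicate hi]; omega
    · have := hq.2.2 i hi; omega
  · intro s _
    exact hsplit s
  · rintro ⟨x, s⟩ hq
    have hs : ∀ i ∈ s, i ≠ k + 1 := by
      intro i hi
      have := (mem_boundedTypes.1 (mem_sigma.1 hq).2).2 i hi
      omega
    have h1 : s.count (k + 1) = 0 := Multiset.count_eq_zero.2 fun h => hs _ h rfl
    have h2 : s.filter (· ≠ k + 1) = s := Multiset.filter_eq_self.2 hs
    have h3 : (Multiset.replicate x (k + 1)).filter (· ≠ k + 1) = 0 :=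
      Multiset.filter_eq_nil.2 fun i hi => by simp [Multiset.eq_of_mem_replicate hi]
    dsimp only
    rw [Multiset.count_add, Multiset.count_replicate_self, h1, Multiset.filter_add, h2, h3,
      add_zero, zero_add]
  · intro s _
    rw [hsplit s]

/-- The probability that all cycles of a random permutation of degree `n` have length at
most `k`. -/
noncomputable def boundedProb (k n : ℕ) : ℝ := ∑ s ∈ boundedTypes k n, cycleWeight s

theorem boundedProb_nonneg (k n : ℕ) : 0 ≤ boundedProb k n :=
  Finset.sum_nonneg fun _ _ => cycleWeight_nonneg _

theorem boundedProb_zero (n : ℕ) : boundedProb 0 n = if n = 0 then 1 else 0 := by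
  rw [boundedProb, boundedTypes_zero]
  split_ifs <;> simp [cycleWeight]

theorem boundedProb_succ (k n : ℕ) :
    boundedProb (k + 1) n = ∑ x ∈ range (n / (k + 1) + 1),
      boundedProb k (n - x * (k + 1)) * (((k : ℝ) + 1) ^ x * x !)⁻¹ := by
  rw [boundedProb, sum_boundedTypes_succ]
  refine Finset.sum_congr rfl fun x _ => ?_
  rw [boundedProb, Finset.sum_mul]
  refine Finset.sum_congr rfl fun s hs => ?_
  rw [cycleWeight_replicate_add_of_notMem, Nat.cast_succ]
  intro h
  have := (mem_boundedTypes.1 hs).2 _ h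
  omega

theorem decompProb_le_boundedProb_sq (k n : ℕ) : decompProb k n ≤ boundedProb k n ^ 2 := by
  classical
  rw [sq, boundedProb, Finset.sum_mul_sum, ← Finset.sum_product', decompProb]
  refine Finset.sum_le_sum_of_subset_of_nonneg (fun p hp => ?_)
    fun _ _ _ => mul_nonneg (cycleWeight_nonneg _) (cycleWeight_nonneg _)
  obtain ⟨hp1, hp2⟩ := mem_filter.1 hp
  obtain ⟨h1, h2⟩ := mem_product.1 hp1
  exact mem_product.2 ⟨mem_filter.2 ⟨h1, fun i hi => (hp2.pos_le_of_mem hi).2⟩,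
    mem_filter.2 ⟨h2, fun i hi => (hp2.symm.pos_le_of_mem hi).2⟩⟩

/-- Permutations without long cycles are exponentially rare; this is the Chernoff bound at `2` for
the generating function `∑ boundedProb k n * z ^ n = ∏ exp (z ^ j / j)`. -/
theorem boundedProb_le (k n : ℕ) :
    boundedProb k n ≤ Real.exp (∑ j ∈ range k, 2 ^ (j + 1) / ((j : ℝ) + 1)) * (1 / 2) ^ n := by
  induction k generalizing n with
  | zero =>
    rw [boundedProb_zero]
    split_ifs with h
    · simp [h]
    · positivity
  | succ k ih =>
    rw [boundedProb_succ, Finset.sum_range_succ _ k, Real.exp_add]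
    set E := Real.exp (∑ j ∈ range k, 2 ^ (j + 1) / ((j : ℝ) + 1))
    set r : ℝ := 2 ^ (k + 1) / ((k : ℝ) + 1) with hr
    have hterm : ∀ x ∈ range (n / (k + 1) + 1),
        boundedProb k (n - x * (k + 1)) * (((k : ℝ) + 1) ^ x * x !)⁻¹ ≤
          E * (1 / 2) ^ n * (r ^ x / x !) := by
      intro x hx
      rw [mem_range, Nat.lt_succ_iff, Nat.le_div_iff_mul_le (by omega)] at hx
      have hpow : ((1 : ℝ) / 2) ^ (n - x * (k + 1)) = (1 / 2) ^ n * (2 ^ (k + 1)) ^ x := by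
        rw [← pow_mul, mul_comm (k + 1) x]
        conv_rhs => rw [← Nat.sub_add_cancel hx, pow_add, mul_assoc, ← mul_pow]
        norm_num
      calc _ ≤ E * (1 / 2) ^ (n - x * (k + 1)) * (((k : ℝ) + 1) ^ x * x !)⁻¹ :=
            mul_le_mul_of_nonneg_right (ih _) (by positivity)
        _ = _ := by rw [hpow, hr, div_pow, mul_inv]; ring
    calc _ ≤ ∑ x ∈ range (n / (k + 1) + 1), E * (1 / 2) ^ n * (r ^ x / x !) :=
          Finset.sum_le_sum hterm
      _ = E * (1 / 2) ^ n * ∑ x ∈ range (n / (k + 1) + 1), r ^ x / x ! := by rw [Finset.mul_sum]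
      _ ≤ E * (1 / 2) ^ n * Real.exp r :=
          mul_le_mul_of_nonneg_left (Real.sum_le_exp_of_nonneg (by positivity) _) (by positivity)
      _ = _ := by ring

theorem decompProb_le_exp (k n : ℕ) :
    decompProb k n ≤ Real.exp (∑ j ∈ range k, 2 ^ (j + 1) / ((j : ℝ) + 1)) ^ 2 * (1 / 4) ^ n := by
  refine (decompProb_le_boundedProb_sq k n).trans
    ((pow_le_pow_left₀ (boundedProb_nonneg k n) (boundedProb_le k n) 2).trans_eq ?_)
  rw [mul_pow, ← pow_mul, mul_comm n 2, pow_mul]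
  norm_num

theorem sum_sq_div_factorial_le (n : ℕ) :
    ∑ x ∈ Icc 2 n, (x : ℝ) ^ 2 / x ! ≤ 5 := by
  have key : ∀ m : ℕ, ∑ x ∈ Icc 2 (m + 2), (x : ℝ) ^ 2 / x ! ≤ 5 - 3 / (m + 1)! := by
    intro m
    induction m with
    | zero => norm_num
    | succ m ih =>
      rw [show m + 1 + 2 = (m + 2) + 1 by ring, Finset.sum_Icc_succ_top (by omega)]
      have h1 : ((m + 1 + 2)! : ℝ) = (m + 3) * ((m + 2) * (m + 1)!) := by
        rw [show m + 1 + 2 = (m + 2) + 1 by ring, Nat.factorial_succ, Nat.factorial_succ]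
        push_cast; ring
      have h2 : ((m + 1 + 1)! : ℝ) = (m + 2) * (m + 1)! := by
        rw [Nat.factorial_succ]; push_cast; ring
      have h0 : (0 : ℝ) < (m + 1)! := by positivity
      have h3 : (((m + 1 + 2 : ℕ) : ℝ)) ^ 2 / (m + 1 + 2)! + 3 / (m + 1 + 1)! ≤ 3 / (m + 1)! := by
        rw [h1, h2]
        push_cast
        rw [show ((m : ℝ) + 1 + 2) ^ 2 / ((m + 3) * ((m + 2) * (m + 1)!)) +
          3 / ((m + 2) * (m + 1)!) = ((m + 6) / (m + 2)) / (m + 1)! by field_simp; ring]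
        refine div_le_div_of_nonneg_right ?_ h0.le
        rw [div_le_iff₀ (by positivity)]
        have : (0 : ℝ) ≤ m := Nat.cast_nonneg m
        linarith
      rw [show m + 1 + 2 = (m + 2) + 1 by ring] at h3
      linarith
  rcases Nat.lt_or_ge n 2 with h | h
  · rw [Finset.Icc_eq_empty (by omega)]; norm_num
  · obtain ⟨m, rfl⟩ := Nat.exists_eq_add_of_le' h
    have := key m
    have h0 : (0 : ℝ) ≤ 3 / (m + 1)! := by positivity
    linarith

/-- Among the blocks of size `l`, the one consisting of two `l`-cycles dominates. -/
theorem sizeWeight_le {l : ℕ} (hl : 0 < l) : sizeWeight l ≤ (1 / l + 5 / (l : ℝ) ^ 2) ^ 2 := by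
  have hl0 : (0 : ℝ) < l := by exact_mod_cast hl
  let g : ℕ → ℝ := fun x => (((l / x : ℕ) : ℝ) ^ x * x !)⁻¹
  have hg0 : ∀ x, 0 ≤ g x := fun x => by positivity
  have h1 : sizeWeight l ≤ (∑ x ∈ l.divisors, g x) ^ 2 := by
    rw [← Nat.sum_div_divisors l g, sq, Finset.sum_mul_sum, ← Finset.sum_product', sizeWeight]
    refine (Finset.sum_le_sum fun p hp => ?_).trans
      (Finset.sum_le_sum_of_subset_of_nonneg (Finset.filter_subset _ _)
        fun _ _ _ => mul_nonneg (hg0 _) (hg0 _))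
    obtain ⟨hp1, hp2⟩ := mem_filter.1 hp
    obtain ⟨ha, hb⟩ := mem_product.1 hp1
    refine le_of_eq ?_
    simp only [blockWeight, g]
    rw [Nat.lcm_comm p.2 p.1, hp2, Nat.div_div_self (Nat.dvd_of_mem_divisors ha) hl.ne',
      Nat.div_div_self (Nat.dvd_of_mem_divisors hb) hl.ne']
  have h2 : ∑ x ∈ l.divisors, g x ≤ 1 / l + 5 / (l : ℝ) ^ 2 := by
    rw [← Finset.add_sum_erase _ _ (Nat.one_mem_divisors.2 hl.ne')]
    refine add_le_add (by simp [g]) ?_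
    calc _ ≤ ∑ x ∈ l.divisors.erase 1, (x : ℝ) ^ 2 / x ! / (l : ℝ) ^ 2 := by
          refine Finset.sum_le_sum fun x hx => ?_
          obtain ⟨hx1, hx⟩ := mem_erase.1 hx
          obtain ⟨y, hy⟩ := Nat.dvd_of_mem_divisors hx
          have hx0 : 0 < x := Nat.pos_of_mem_divisors hx
          have hy0 : 0 < y := Nat.pos_of_ne_zero (by rintro rfl; omega)
          have hyr : (1 : ℝ) ≤ y := by exact_mod_cast hy0
          have hxr : (0 : ℝ) < x := by exact_mod_cast hx0
          simp only [g]
          rw [hy, Nat.mul_div_cancel_left _ hx0, Nat.cast_mul, mul_pow, div_div,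
            mul_comm (x ! : ℝ), mul_assoc, ← div_div, div_self (by positivity), one_div]
          refine inv_anti₀ (by positivity) (mul_le_mul_of_nonneg_right ?_ (by positivity))
          exact pow_le_pow_right₀ hyr (by omega)
      _ ≤ ∑ x ∈ Icc 2 l, (x : ℝ) ^ 2 / x ! / (l : ℝ) ^ 2 := by
          refine Finset.sum_le_sum_of_subset_of_nonneg (fun x hx => ?_) fun _ _ _ => by positivity
          obtain ⟨hx1, hx⟩ := mem_erase.1 hx
          have := Nat.divisor_le hx
          have := Nat.pos_of_mem_divisors hx
          rw [mem_Icc]; omega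
      _ ≤ 5 / (l : ℝ) ^ 2 := by
          rw [← Finset.sum_div]
          exact div_le_div_of_nonneg_right (sum_sq_div_factorial_le l) (by positivity)
  exact h1.trans (pow_le_pow_left₀ (Finset.sum_nonneg fun x _ => hg0 x) h2 2)

theorem one_div_sq_le_sizeWeight {l : ℕ} (hl : 0 < l) : 1 / (l : ℝ) ^ 2 ≤ sizeWeight l := by
  have hmem : (l, l) ∈ blockPairs l := by
    simp [blockPairs, hl.ne']
  refine le_trans (le_of_eq ?_)
    (Finset.single_le_sum (fun p _ => blockWeight_nonneg p.1 p.2) hmem)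
  simp [blockWeight, Nat.div_self hl, sq]

theorem sum_sizeWeight_le {k : ℕ} (hk : 0 < k) (N : ℕ) :
    ∑ j ∈ Ioc k N, sizeWeight j ≤ (1 + 5 / (k : ℝ)) ^ 2 / k := by
  have hk0 : (0 : ℝ) < k := by exact_mod_cast hk
  have h1 : ∑ j ∈ Ioc k N, sizeWeight j ≤
      (1 + 5 / (k : ℝ)) ^ 2 * ∑ j ∈ Ioc k N, ((j : ℝ) ^ 2)⁻¹ := by
    rw [Finset.mul_sum]
    refine Finset.sum_le_sum fun j hj => ?_
    obtain ⟨hkj, -⟩ := mem_Ioc.1 hj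
    have hkj' : (k : ℝ) ≤ j := by exact_mod_cast hkj.le
    have hj0 : (0 : ℝ) < j := hk0.trans_le hkj'
    calc sizeWeight j ≤ (1 / j + 5 / (j : ℝ) ^ 2) ^ 2 := sizeWeight_le (by omega)
      _ = (1 + 5 / (j : ℝ)) ^ 2 * ((j : ℝ) ^ 2)⁻¹ := by field_simp
      _ ≤ _ := by gcongr
  rcases le_total k N with h | h
  · have h2 := sum_Ioc_inv_sq_le_sub (α := ℝ) hk.ne' h
    have h3 : (0 : ℝ) ≤ (N : ℝ)⁻¹ := by positivity
    rw [div_eq_mul_inv]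
    exact h1.trans (mul_le_mul_of_nonneg_left (by linarith) (by positivity))
  · rw [Finset.Ioc_eq_empty (by omega), Finset.sum_empty]; positivity

theorem sum_sizeWeight_le_const_div {k : ℕ} (hk : 0 < k) (N : ℕ) :
    ∑ j ∈ Ioc k N, sizeWeight j ≤ 36 / k := by
  refine (sum_sizeWeight_le hk N).trans (div_le_div_of_nonneg_right ?_ (Nat.cast_nonneg k))
  have h1 : 5 / (k : ℝ) ≤ 5 := div_le_self (by norm_num) (by exact_mod_cast hk)
  have h2 : 0 ≤ 5 / (k : ℝ) := by positivity
  nlinarith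

/-! ### Convergence and the asymptotic formula -/

/-- The sum over all degrees converges when only blocks of size at most `k` are allowed. -/
theorem sum_decompProb_le (k N : ℕ) :
    ∑ n ∈ range N, decompProb k n ≤
      2 * Real.exp (∑ j ∈ range k, 2 ^ (j + 1) / ((j : ℝ) + 1)) ^ 2 := by
  set E := Real.exp (∑ j ∈ range k, 2 ^ (j + 1) / ((j : ℝ) + 1))
  have hgeom : ∑ n ∈ range N, ((1 : ℝ) / 4) ^ n ≤ 2 := by
    rw [geom_sum_eq (by norm_num)]
    have : (0 : ℝ) ≤ (1 / 4) ^ N := by positivity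
    rw [div_le_iff_of_neg (by norm_num)]
    linarith
  calc _ ≤ ∑ n ∈ range N, E ^ 2 * (1 / 4) ^ n :=
        Finset.sum_le_sum fun n _ => decompProb_le_exp k n
    _ = E ^ 2 * ∑ n ∈ range N, (1 / 4 : ℝ) ^ n := by rw [Finset.mul_sum]
    _ ≤ _ := by nlinarith [sq_nonneg E]

/-- Blocks larger than `72` carry total weight at most `1 / 2`, so they can at most double the
convergent sum over pairs decomposable into smaller blocks. -/
theorem summable_rhoSymm : Summable rhoSymm := by
  refine summable_of_sum_range_le (c := 2 * (2 *
    Real.exp (∑ j ∈ range 72, 2 ^ (j + 1) / ((j : ℝ) + 1)) ^ 2)) rhoSymm_nonneg fun N => ?_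
  have h1 := sum_rhoSymm_le 72 N
  have h2 := sum_sizeWeight_le_const_div (k := 72) (by norm_num) N
  have h3 := sum_decompProb_le 72 N
  have h0 : 0 ≤ ∑ n ∈ range N, rhoSymm n := Finset.sum_nonneg fun _ _ => rhoSymm_nonneg _
  have h4 : (1 / 2 : ℝ) * ∑ n ∈ range N, rhoSymm n ≤
      (1 - ∑ j ∈ Ioc 72 N, sizeWeight j) * ∑ n ∈ range N, rhoSymm n := by
    refine mul_le_mul_of_nonneg_right ?_ h0
    norm_num at h2
    linarith
  linarith

theorem sum_range_rhoSymm_le_Arho (N : ℕ) : ∑ n ∈ range N, rhoSymm n ≤ Arho :=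
  summable_rhoSymm.sum_le_tsum _ fun _ _ => rhoSymm_nonneg _

/-- If `v j ∼ 1 / j ^ 2`, then the part of the convolution of `v` with a summable sequence `r` where
`v` carries more than half of the index is asymptotic to `(∑ r) / n ^ 2`. -/
theorem tendsto_sq_mul_half_convolution {r v : ℕ → ℝ} (hr : Summable r) (hr0 : ∀ n, 0 ≤ r n)
    (hv : Tendsto (fun j : ℕ => (j : ℝ) ^ 2 * v j) atTop (𝓝 1)) {K : ℝ}
    (hv0 : ∀ j, 0 ≤ v j) (hK : ∀ j : ℕ, (j : ℝ) ^ 2 * v j ≤ K) :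
    Tendsto (fun n : ℕ => (n : ℝ) ^ 2 * ∑ m ∈ range n with 2 * m < n, v (n - m) * r m) atTop
      (𝓝 (∑' m, r m)) := by
  have key : Tendsto (fun n : ℕ => ∑' m, if 2 * m < n then (n : ℝ) ^ 2 * (v (n - m) * r m) else 0)
      atTop (𝓝 (∑' m, r m)) := by
    refine tendsto_tsum_of_dominated_convergence (bound := fun m => 4 * K * r m)
      (hr.mul_left _) (fun m => ?_) (Eventually.of_forall fun n m => ?_)
    · have h1 : Tendsto (fun n : ℕ => ((n - m : ℕ) : ℝ) ^ 2 * v (n - m)) atTop (𝓝 1) :=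
        hv.comp (tendsto_sub_atTop_nat m)
      have h2 : Tendsto (fun n : ℕ => ((n : ℝ) / (n + (-m : ℝ))) ^ 2) atTop (𝓝 1) := by
        simpa using (tendsto_natCast_div_add_atTop (-m : ℝ)).pow 2
      have h3 := (h2.mul h1).mul_const (r m)
      rw [one_mul, one_mul] at h3
      refine h3.congr' ?_
      filter_upwards [eventually_gt_atTop (2 * m)] with n hn
      have hnm : (0 : ℝ) < (n : ℝ) - m := by
        have : (m : ℝ) < n := by exact_mod_cast (by omega : m < n)
        linarith
      rw [if_pos hn, Nat.cast_sub (by omega), ← sub_eq_add_neg]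
      field_simp
    · split_ifs with hn
      · rw [Real.norm_of_nonneg (by have := hr0 m; have := hv0 (n - m); positivity)]
        have h1 : (n : ℝ) ^ 2 ≤ 4 * ((n - m : ℕ) : ℝ) ^ 2 := by
          have : (n : ℝ) ≤ 2 * ((n - m : ℕ) : ℝ) := by exact_mod_cast (by omega : n ≤ 2 * (n - m))
          nlinarith [Nat.cast_nonneg (α := ℝ) n]
        have h2 := mul_le_mul_of_nonneg_right h1 (mul_nonneg (hv0 (n - m)) (hr0 m))
        have h3 := mul_le_mul_of_nonneg_right (hK (n - m)) (hr0 m)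
        linarith
      · have : 0 ≤ K := by simpa using hK 0
        rw [norm_zero]
        have := hr0 m
        positivity
  refine key.congr fun n => ?_
  rw [tsum_eq_sum (s := range n), ← Finset.sum_filter, Finset.mul_sum]
  intro m hm
  rw [mem_range] at hm
  rw [if_neg (by omega)]

theorem tendsto_sq_mul_sizeWeight :
    Tendsto (fun j : ℕ => (j : ℝ) ^ 2 * sizeWeight j) atTop (𝓝 1) := by
  have hup : Tendsto (fun j : ℕ => (1 + 5 / (j : ℝ)) ^ 2) atTop (𝓝 1) := by
    simpa using ((tendsto_const_div_atTop_nhds_zero_nat (5 : ℝ)).const_add 1).pow 2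
  refine tendsto_of_tendsto_of_tendsto_of_le_of_le' tendsto_const_nhds hup ?_ ?_
  · filter_upwards [eventually_gt_atTop 0] with j hj
    have hj0 : (0 : ℝ) < j := by exact_mod_cast hj
    have := mul_le_mul_of_nonneg_left (one_div_sq_le_sizeWeight hj) (sq_nonneg (j : ℝ))
    rwa [mul_one_div_cancel (by positivity)] at this
  · filter_upwards [eventually_gt_atTop 0] with j hj
    have hj0 : (0 : ℝ) < j := by exact_mod_cast hj
    refine (mul_le_mul_of_nonneg_left (sizeWeight_le hj) (sq_nonneg (j : ℝ))).trans_eq ?_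
    rw [← mul_pow]
    congr 1
    field_simp

theorem sq_mul_sizeWeight_le (j : ℕ) : (j : ℝ) ^ 2 * sizeWeight j ≤ 36 := by
  rcases Nat.eq_zero_or_pos j with rfl | hj
  · simp
  · have hj0 : (0 : ℝ) < j := by exact_mod_cast hj
    have h1 : 5 / (j : ℝ) ≤ 5 := div_le_self (by norm_num) (by exact_mod_cast hj)
    have h2 : 0 ≤ 5 / (j : ℝ) := by positivity
    calc _ ≤ (j : ℝ) ^ 2 * (1 / j + 5 / (j : ℝ) ^ 2) ^ 2 :=
          mul_le_mul_of_nonneg_left (sizeWeight_le hj) (sq_nonneg (j : ℝ))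
      _ = (1 + 5 / (j : ℝ)) ^ 2 := by field_simp
      _ ≤ 36 := by nlinarith

/-- The upper recursion for `n ^ 2 * rhoSymm n`. A removed block of size at most `n / 2` leaves a
degree at least `n / 2`, where the bound `D` applies; the larger blocks give the main term. -/
theorem sq_mul_rhoSymm_le {k n : ℕ} (hk : 0 < k) {D : ℝ} (hD0 : 0 ≤ D)
    (hD : ∀ m < n, (m : ℝ) ^ 2 * rhoSymm m ≤ D) :
    (n : ℝ) ^ 2 * rhoSymm n ≤ (n : ℝ) ^ 2 * decompProb k n + 144 * D / k +
      (n : ℝ) ^ 2 * ∑ m ∈ range n with 2 * m < n, sizeWeight (n - m) * rhoSymm m := by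
  have h := mul_le_mul_of_nonneg_left (rhoSymm_le_decompProb_add k n) (sq_nonneg (n : ℝ))
  rw [mul_add, ← Finset.sum_filter_add_sum_filter_not _ (fun j => 2 * j ≤ n), mul_add] at h
  have hsmall : (n : ℝ) ^ 2 * ∑ j ∈ Ioc k n with 2 * j ≤ n, sizeWeight j * rhoSymm (n - j) ≤
      144 * D / k := by
    calc _ ≤ ∑ j ∈ Ioc k n with 2 * j ≤ n, sizeWeight j * (4 * D) := by
          rw [Finset.mul_sum]
          refine Finset.sum_le_sum fun j hj => ?_
          obtain ⟨hj1, hj2⟩ := mem_filter.1 hj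
          rw [mem_Ioc] at hj1
          have h1 : (n : ℝ) ≤ 2 * ((n - j : ℕ) : ℝ) := by exact_mod_cast (by omega)
          have h2 : (n : ℝ) ^ 2 ≤ 4 * ((n - j : ℕ) : ℝ) ^ 2 := by
            nlinarith [Nat.cast_nonneg (α := ℝ) n]
          have h3 := mul_le_mul_of_nonneg_right h2 (rhoSymm_nonneg (n - j))
          have h4 := hD (n - j) (by omega)
          have h5 := mul_le_mul_of_nonneg_left (show (n : ℝ) ^ 2 * rhoSymm (n - j) ≤ 4 * D by
            linarith) (sizeWeight_nonneg j)
          linarith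
      _ ≤ ∑ j ∈ Ioc k n, sizeWeight j * (4 * D) :=
          Finset.sum_le_sum_of_subset_of_nonneg (Finset.filter_subset _ _)
            fun j _ _ => mul_nonneg (sizeWeight_nonneg j) (by positivity)
      _ = (∑ j ∈ Ioc k n, sizeWeight j) * (4 * D) := by rw [Finset.sum_mul]
      _ ≤ 36 / k * (4 * D) :=
          mul_le_mul_of_nonneg_right (sum_sizeWeight_le_const_div hk n) (by positivity)
      _ = _ := by ring
  have hlarge : ∑ j ∈ Ioc k n with ¬ 2 * j ≤ n, sizeWeight j * rhoSymm (n - j) ≤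
      ∑ m ∈ range n with 2 * m < n, sizeWeight (n - m) * rhoSymm m := by
    have hinj : ∀ a ∈ (Ioc k n).filter (fun j => ¬ 2 * j ≤ n),
        ∀ b ∈ (Ioc k n).filter (fun j => ¬ 2 * j ≤ n), n - a = n - b → a = b := by
      intro a ha b hb hab
      rw [mem_filter, mem_Ioc] at ha hb
      omega
    have heq : ∑ j ∈ Ioc k n with ¬ 2 * j ≤ n, sizeWeight j * rhoSymm (n - j) =
        ∑ j ∈ Ioc k n with ¬ 2 * j ≤ n, sizeWeight (n - (n - j)) * rhoSymm (n - j) := by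
      refine Finset.sum_congr rfl fun j hj => ?_
      rw [mem_filter, mem_Ioc] at hj
      rw [Nat.sub_sub_self hj.1.2]
    rw [heq, ← Finset.sum_image (f := fun m => sizeWeight (n - m) * rhoSymm m) hinj]
    refine Finset.sum_le_sum_of_subset_of_nonneg (fun m hm => ?_)
      fun _ _ _ => mul_nonneg (sizeWeight_nonneg _) (rhoSymm_nonneg _)
    obtain ⟨j, hj, rfl⟩ := mem_image.1 hm
    rw [mem_filter, mem_Ioc] at hj
    rw [mem_filter, mem_range]
    omega
  have := mul_le_mul_of_nonneg_left hlarge (sq_nonneg (n : ℝ))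
  linarith

theorem tendsto_sq_mul_decompProb (k : ℕ) :
    Tendsto (fun n : ℕ => (n : ℝ) ^ 2 * decompProb k n) atTop (𝓝 0) := by
  have h := (tendsto_pow_const_mul_const_pow_of_abs_lt_one 2
    (show |(1 / 4 : ℝ)| < 1 by norm_num [abs_of_pos])).const_mul
    (Real.exp (∑ j ∈ range k, 2 ^ (j + 1) / ((j : ℝ) + 1)) ^ 2)
  rw [mul_zero] at h
  refine squeeze_zero (fun n => mul_nonneg (sq_nonneg _) (decompProb_nonneg k n)) (fun n => ?_) h
  refine (mul_le_mul_of_nonneg_left (decompProb_le_exp k n) (sq_nonneg (n : ℝ))).trans_eq ?_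
  ring

theorem tendsto_sq_mul_large_blocks :
    Tendsto (fun n : ℕ => (n : ℝ) ^ 2 * ∑ m ∈ range n with 2 * m < n,
      sizeWeight (n - m) * rhoSymm m) atTop (𝓝 Arho) :=
  tendsto_sq_mul_half_convolution summable_rhoSymm rhoSymm_nonneg tendsto_sq_mul_sizeWeight
    sizeWeight_nonneg sq_mul_sizeWeight_le

/-- With `k = 288` the middle term of `sq_mul_rhoSymm_le` is `D / 2`, so the bound `D` reproduces
itself. -/
theorem exists_sq_mul_rhoSymm_le : ∃ D, 0 ≤ D ∧ ∀ n : ℕ, (n : ℝ) ^ 2 * rhoSymm n ≤ D := by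
  obtain ⟨B, hB⟩ := ((tendsto_sq_mul_decompProb 288).add tendsto_sq_mul_large_blocks).bddAbove_range
  have hB' : ∀ n : ℕ, (n : ℝ) ^ 2 * decompProb 288 n + (n : ℝ) ^ 2 * ∑ m ∈ range n with 2 * m < n,
      sizeWeight (n - m) * rhoSymm m ≤ B := fun n => hB ⟨n, rfl⟩
  have hB0 : 0 ≤ B := by simpa using hB' 0
  refine ⟨2 * B, by positivity, fun n => ?_⟩
  induction n using Nat.strong_induction_on with
  | _ n ih =>
    have h := sq_mul_rhoSymm_le (k := 288) (by norm_num) (by positivity) ih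
    have := hB' n
    push_cast at h
    linarith

/-- The lower recursion tends to `Arho`; in the upper one the blocks of size between `k` and `n / 2`
contribute an error `O (1 / k)` uniformly in `n`, and `k` is chosen after the tolerance. -/
theorem tendsto_sq_mul_rhoSymm :
    Tendsto (fun n : ℕ => (n : ℝ) ^ 2 * rhoSymm n) atTop (𝓝 Arho) := by
  rw [tendsto_order]
  constructor
  · intro a ha
    have hlow := tendsto_sq_mul_half_convolution (v := fun j : ℕ => 1 / (j : ℝ) ^ 2) (K := 1)
      summable_rhoSymm rhoSymm_nonneg
      (tendsto_const_nhds.congr' (by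
        filter_upwards [eventually_gt_atTop 0] with j hj
        have : (j : ℝ) ≠ 0 := by exact_mod_cast hj.ne'
        rw [mul_one_div_cancel (by positivity)]))
      (fun j => by positivity) (fun j => by rw [mul_one_div]; exact div_self_le_one _)
    filter_upwards [hlow.eventually (lt_mem_nhds ha)] with n hn
    refine hn.trans_le (mul_le_mul_of_nonneg_left ?_ (sq_nonneg _))
    refine le_trans (le_of_eq (Finset.sum_congr rfl fun m hm => ?_)) (sum_rhoSymm_div_le n)
    rw [mem_filter, mem_range] at hm
    rw [Nat.cast_sub hm.1.le]
    ring
  · intro a ha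
    obtain ⟨D, hD0, hD⟩ := exists_sq_mul_rhoSymm_le
    obtain ⟨k, hk⟩ := exists_nat_gt (max 0 (288 * D / (a - Arho)))
    have hk0 : (0 : ℝ) < k := (le_max_left _ _).trans_lt hk
    have hk1 : 144 * D / k < (a - Arho) := by
      have h1 := (le_max_right _ _).trans_lt hk
      rw [div_lt_iff₀ (by linarith)] at h1
      rw [div_lt_iff₀ hk0]
      nlinarith
    have hlim := ((tendsto_sq_mul_decompProb k).add tendsto_sq_mul_large_blocks).eventually
      (gt_mem_nhds (show 0 + Arho < a - 144 * D / k by linarith))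
    filter_upwards [hlim] with n hn
    have := sq_mul_rhoSymm_le (k := k) (n := n) (by exact_mod_cast hk0) hD0 fun m _ => hD m
    linarith

theorem isEquivalent_rhoSymm (hA : Arho ≠ 0) :
    Asymptotics.IsEquivalent atTop rhoSymm (fun n : ℕ => Arho / (n : ℝ) ^ 2) := by
  refine Asymptotics.isEquivalent_of_tendsto_one ?_
  have h := tendsto_sq_mul_rhoSymm.div_const Arho
  rw [div_self hA] at h
  refine h.congr fun n => ?_
  simp only [Pi.div_apply]
  rw [div_div_eq_mul_div, mul_comm]

/-! ### Computing with partitions -/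

/-- The partitions of `n` into parts at most `k`, as the lists of the multiplicities of
`k, k - 1, …, 1`. -/
def countLists : ℕ → ℕ → List (List ℕ)
  | 0, n => if n = 0 then [[]] else []
  | k + 1, n => (List.range (n / (k + 1) + 1)).flatMap fun x =>
      (countLists k (n - x * (k + 1))).map (x :: ·)

/-- The multiset of parts with given multiplicities; the head of the list is the multiplicity of
the largest possible part, which is the length of the list. -/
def ofCounts : List ℕ → Multiset ℕ
  | [] => 0
  | x :: l => Multiset.replicate x (l.length + 1) + ofCounts l

/-- The order of the centralizer of a permutation with the given cycle multiplicities. -/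
def centralizerCard : List ℕ → ℕ
  | [] => 1
  | x :: l => (l.length + 1) ^ x * x ! * centralizerCard l

/-- The multiplicities left after removing `c` parts equal to `b`, if there are as many. -/
def removeParts : List ℕ → ℕ → ℕ → Option (List ℕ)
  | [], _, _ => none
  | x :: l, b, c =>
    if l.length + 1 = b then (if c ≤ x then some ((x - c) :: l) else none)
    else (removeParts l b c).map (x :: ·)

/-- A search for a decomposition into blocks of size at most `k`, which removes a block involving
the largest part present. The answer is `d` if the number of steps exceeds the first numerical
argument. -/
def searchDecomp (d : Bool) (k : ℕ) : ℕ → List ℕ → List ℕ → Bool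
  | 0, _, _ => d
  | f + 1, x :: l, y :: l' =>
    if x = 0 then
      if y = 0 then searchDecomp d k f l l' else searchDecomp d k f (y :: l') (x :: l)
    else (List.range (l.length + 1)).any fun b =>
      decide (Nat.lcm (l.length + 1) (b + 1) ≤ k) &&
        (match removeParts (x :: l) (l.length + 1)
            (Nat.lcm (l.length + 1) (b + 1) / (l.length + 1)),
          removeParts (y :: l') (b + 1) (Nat.lcm (b + 1) (l.length + 1) / (b + 1)) with
        | some u, some v => searchDecomp d k f u v
        | _, _ => false)
  | _ + 1, _, _ => true

/-- The number of permutations of degree `n` with the given cycle multiplicities. -/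
def classCard (n : ℕ) (l : List ℕ) : ℕ := n ! / centralizerCard l

/-- The number of permutations of degree `n` with all cycles of length at most `k`. -/
def boundedCount (k n : ℕ) : ℕ := ((countLists k n).map (classCard n)).sum

/-- The number of pairs of permutations of degree `n` for whose cycle types the search
succeeds. For `d = false` it is a lower bound, and for `d = true` an upper bound, for
`n ! ^ 2 * decompProb k n`. -/
def pairCount (d : Bool) (k n : ℕ) : ℕ :=
  ((countLists k n).map fun l => ((countLists k n).map fun l' =>
    if searchDecomp d k (3 * n + k + 1) l l' then
      classCard n l * classCard n l' else 0).sum).sum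

theorem length_of_mem_countLists {k n : ℕ} {l : List ℕ} (hl : l ∈ countLists k n) :
    l.length = k := by
  induction k generalizing n l with
  | zero => rw [countLists] at hl; split_ifs at hl <;> simp_all
  | succ k ih =>
    simp only [countLists, List.mem_flatMap, List.mem_map] at hl
    obtain ⟨x, -, u, hu, rfl⟩ := hl
    simp [ih hu]

/-- `countLists k n` enumerates `boundedTypes k n` without repetition. -/
theorem sum_boundedTypes_eq {M : Type*} [AddCommMonoid M] (f : Multiset ℕ → M) (k n : ℕ) :
    ∑ s ∈ boundedTypes k n, f s = ((countLists k n).map fun l => f (ofCounts l)).sum := by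
  induction k generalizing f n with
  | zero =>
    rw [boundedTypes_zero, countLists]
    split_ifs <;> simp [ofCounts]
  | succ k ih =>
    rw [sum_boundedTypes_succ, countLists, List.map_flatMap, List.flatMap_def, List.sum_flatten,
      List.map_map, ← Multiset.sum_coe, ← Multiset.map_coe]
    change (Multiset.map _ (Multiset.range _)).sum = (Multiset.map _ (Multiset.range _)).sum
    congr 1
    refine Multiset.map_congr rfl fun x _ => ?_
    rw [ih, comp_apply, List.map_map]
    congr 1
    refine List.map_congr_left fun l hl => ?_
    simp [ofCounts, length_of_mem_countLists hl]

theorem pos_le_of_mem_ofCounts {l : List ℕ} {i : ℕ} (hi : i ∈ ofCounts l) :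
    0 < i ∧ i ≤ l.length := by
  induction l with
  | nil => simp [ofCounts] at hi
  | cons x l ih =>
    rw [ofCounts, Multiset.mem_add] at hi
    rw [List.length_cons]
    rcases hi with hi | hi
    · rw [Multiset.eq_of_mem_replicate hi]; omega
    · have := ih hi; omega

theorem sum_ofCounts_of_mem_countLists {k n : ℕ} {l : List ℕ} (hl : l ∈ countLists k n) :
    (ofCounts l).sum = n := by
  induction k generalizing n l with
  | zero => rw [countLists] at hl; split_ifs at hl <;> simp_all [ofCounts]
  | succ k ih =>
    simp only [countLists, List.mem_flatMap, List.mem_map, List.mem_range, Nat.lt_succ_iff] at hl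
    obtain ⟨x, hx, u, hu, rfl⟩ := hl
    rw [Nat.le_div_iff_mul_le (by omega)] at hx
    rw [ofCounts, Multiset.sum_add, Multiset.sum_replicate, length_of_mem_countLists hu, ih hu,
      smul_eq_mul]
    omega

theorem ofCounts_mem_cycleTypes {k n : ℕ} {l : List ℕ} (hl : l ∈ countLists k n) :
    ofCounts l ∈ cycleTypes n :=
  mem_cycleTypes.2 ⟨sum_ofCounts_of_mem_countLists hl, fun _ hi => (pos_le_of_mem_ofCounts hi).1⟩

theorem notMem_ofCounts (l : List ℕ) : l.length + 1 ∉ ofCounts l := fun h => by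
  have := (pos_le_of_mem_ofCounts h).2
  omega

theorem cycleWeight_ofCounts (l : List ℕ) :
    cycleWeight (ofCounts l) = (centralizerCard l : ℝ)⁻¹ := by
  induction l with
  | nil => simp [ofCounts, centralizerCard, cycleWeight]
  | cons x l ih =>
    rw [ofCounts, cycleWeight_replicate_add_of_notMem _ (notMem_ofCounts l), ih, centralizerCard]
    push_cast
    rw [← mul_inv, mul_comm]

theorem centralizerCard_pos (l : List ℕ) : 0 < centralizerCard l := by
  induction l with
  | nil => simp [centralizerCard]
  | cons x l ih => rw [centralizerCard]; positivity

/-- The truncated division in `classCard` is exact, since it counts a conjugacy class. -/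
theorem cast_classCard {k n : ℕ} {l : List ℕ} (hl : l ∈ countLists k n) :
    (classCard n l : ℝ) = n ! * cycleWeight (ofCounts l) := by
  have h := card_partition_parts_eq (ofCounts_mem_cycleTypes hl)
  have hc : (centralizerCard l : ℝ) ≠ 0 := by exact_mod_cast (centralizerCard_pos l).ne'
  rw [cycleWeight_ofCounts, ← div_eq_mul_inv] at h ⊢
  rw [eq_div_iff hc] at h
  have h' : #{g : Equiv.Perm (Fin n) | g.partition.parts = ofCounts l} * centralizerCard l =
      n ! := by
    exact_mod_cast h
  rw [classCard, Nat.cast_div (Dvd.intro_left _ h') hc]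

theorem cast_boundedCount (k n : ℕ) : (boundedCount k n : ℝ) = n ! * boundedProb k n := by
  rw [boundedCount, boundedProb, sum_boundedTypes_eq, Nat.cast_list_sum, List.map_map,
    ← List.sum_map_mul_left]
  congr 1
  exact List.map_congr_left fun l hl => cast_classCard hl

theorem removeParts_sound {l u : List ℕ} {b c : ℕ} (h : removeParts l b c = some u) :
    u.length = l.length ∧ ofCounts l = Multiset.replicate c b + ofCounts u := by
  induction l generalizing u with
  | nil => simp [removeParts] at h
  | cons x l ih =>
    rw [removeParts] at h
    split_ifs at h with hb hc
    · obtain rfl : _ = u := Option.some.inj h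
      refine ⟨by simp, ?_⟩
      rw [ofCounts, ofCounts, ← add_assoc, hb, ← Multiset.replicate_add, Nat.add_sub_cancel' hc]
    · obtain ⟨v, hv, rfl⟩ := Option.map_eq_some_iff.1 h
      obtain ⟨h1, h2⟩ := ih hv
      refine ⟨by simp [h1], ?_⟩
      rw [ofCounts, ofCounts, h1, h2, add_left_comm]

theorem removeParts_complete {l : List ℕ} {b c : ℕ} {s : Multiset ℕ} (hc : 0 < c)
    (h : ofCounts l = Multiset.replicate c b + s) :
    ∃ u, removeParts l b c = some u ∧ ofCounts u = s := by
  have key : ∀ l : List ℕ, c ≤ (ofCounts l).count b → ∃ u, removeParts l b c = some u := by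
    intro l
    induction l with
    | nil => intro h; simp [ofCounts] at h; omega
    | cons x l ih =>
      intro h
      rw [ofCounts, Multiset.count_add, Multiset.count_replicate] at h
      rw [removeParts]
      split_ifs at h ⊢ with hb hcx
      · exact ⟨_, rfl⟩
      · rw [← hb, Multiset.count_eq_zero.2 (notMem_ofCounts l)] at h; omega
      · obtain ⟨u, hu⟩ := ih (by omega)
        exact ⟨_, by rw [hu]; rfl⟩
  obtain ⟨u, hu⟩ := key l (by rw [h]; simp)
  refine ⟨u, hu, ?_⟩
  have := (removeParts_sound hu).2
  rw [h] at this
  exact (add_left_cancel this).symm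

/-- With default answer `false`, a successful search yields a decomposition. -/
theorem searchDecomp_sound {k f : ℕ} {l l' : List ℕ} (hlen : l.length = l'.length)
    (h : searchDecomp false k f l l' = true) : BlockDecomp k (ofCounts l) (ofCounts l') := by
  induction f generalizing l l' with
  | zero => simp [searchDecomp] at h
  | succ f ih =>
    rcases l with _ | ⟨x, l⟩ <;> rcases l' with _ | ⟨y, l'⟩
    · exact .zero
    · simp at hlen
    · simp at hlen
    · rw [searchDecomp] at h
      split_ifs at h with hx hy
      · subst hx hy
        simpa [ofCounts] using ih (by simpa using hlen) h
      · exact (ih hlen.symm h).symm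
      · rw [List.any_eq_true] at h
        obtain ⟨b, -, h⟩ := h
        rw [Bool.and_eq_true, decide_eq_true_eq] at h
        obtain ⟨hk, h⟩ := h
        split at h
        · next u v hu hv =>
          obtain ⟨hu1, hu2⟩ := removeParts_sound hu
          obtain ⟨hv1, hv2⟩ := removeParts_sound hv
          rw [hu2, hv2]
          exact .add _ _ (by omega) (by omega) hk (ih (by omega) h)
        · simp at h

/-- Every part of the first multiset lies in a block that can be removed; this is why the search may
always start from the largest part. -/
theorem BlockDecomp.exists_block_of_mem {k : ℕ} {s t : Multiset ℕ} (h : BlockDecomp k s t) {i : ℕ}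
    (hi : i ∈ s) : ∃ b s' t', 0 < b ∧ Nat.lcm i b ≤ k ∧ BlockDecomp k s' t' ∧
      s = cycleBlock i b + s' ∧ t = cycleBlock b i + t' := by
  induction h with
  | zero => simp at hi
  | @add s t a b ha hb hk h ih =>
    rcases Multiset.mem_add.1 hi with hi | hi
    · obtain rfl := Multiset.eq_of_mem_replicate hi
      exact ⟨b, s, t, hb, hk, h, rfl, rfl⟩
    · obtain ⟨c, s', t', hc, hk', h', rfl, rfl⟩ := ih hi
      exact ⟨c, _, _, hc, hk', .add a b ha hb hk h', add_left_comm _ _ _, add_left_comm _ _ _⟩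

/-- With default answer `true`, a decomposable pair is never rejected, whatever the number of
steps. -/
theorem searchDecomp_complete {k : ℕ} (f : ℕ) {l l' : List ℕ} (hlen : l.length = l'.length)
    (h : BlockDecomp k (ofCounts l) (ofCounts l')) : searchDecomp true k f l l' = true := by
  induction f generalizing l l' with
  | zero => rfl
  | succ f ih =>
    rcases l with _ | ⟨x, l⟩ <;> rcases l' with _ | ⟨y, l'⟩
    · rfl
    · simp at hlen
    · simp at hlen
    · rw [searchDecomp]
      split_ifs with hx hy
      · subst hx hy
        exact ih (by simpa using hlen) (by simpa [ofCounts] using h)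
      · exact ih hlen.symm h.symm
      · have hmem : l.length + 1 ∈ ofCounts (x :: l) := by
          rw [ofCounts, Multiset.mem_add]
          exact Or.inl (Multiset.mem_replicate.2 ⟨hx, rfl⟩)
        obtain ⟨b, s', t', hb, hk, h', hs, ht⟩ := h.exists_block_of_mem hmem
        have hpos : ∀ a c, 0 < a → 0 < c → 0 < Nat.lcm a c / a := fun a c ha hc =>
          Nat.div_pos (Nat.le_of_dvd (Nat.lcm_pos ha hc) (Nat.dvd_lcm_left a c)) ha
        have hble : b ≤ l.length + 1 := by
          have : b ∈ ofCounts (y :: l') := by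
            rw [ht, Multiset.mem_add]
            exact Or.inl (Multiset.mem_replicate.2 ⟨(hpos b _ hb (by omega)).ne', rfl⟩)
          exact ((pos_le_of_mem_ofCounts this).2.trans hlen.ge)
        obtain ⟨u, hu, rfl⟩ := removeParts_complete (hpos _ _ (by omega) hb) hs
        obtain ⟨v, hv, rfl⟩ := removeParts_complete (hpos _ _ hb (by omega)) ht
        rw [List.any_eq_true]
        refine ⟨b - 1, List.mem_range.2 (by omega), ?_⟩
        rw [Nat.sub_add_cancel hb, Bool.and_eq_true, decide_eq_true_eq, hu, hv]
        refine ⟨hk, ih ?_ h'⟩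
        rw [(removeParts_sound hu).1, (removeParts_sound hv).1, hlen]

open Classical in
theorem factorial_sq_mul_decompProb (k n : ℕ) : (n ! : ℝ) ^ 2 * decompProb k n =
    ((countLists k n).map fun l => ((countLists k n).map fun l' =>
      if BlockDecomp k (ofCounts l) (ofCounts l') then
        (classCard n l : ℝ) * classCard n l' else 0).sum).sum := by
  have h1 : decompProb k n = ∑ s ∈ boundedTypes k n, ∑ t ∈ boundedTypes k n,
      if BlockDecomp k s t then cycleWeight s * cycleWeight t else 0 := by
    rw [← Finset.sum_product', ← Finset.sum_filter, decompProb]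
    refine Finset.sum_congr ?_ fun _ _ => rfl
    ext p
    simp only [mem_filter, mem_product, boundedTypes]
    exact ⟨fun h => ⟨⟨⟨h.1.1, fun i hi => (h.2.pos_le_of_mem hi).2⟩, h.1.2,
      fun i hi => (h.2.symm.pos_le_of_mem hi).2⟩, h.2⟩, fun h => ⟨⟨h.1.1.1, h.1.2.1⟩, h.2⟩⟩
  rw [h1, sum_boundedTypes_eq, ← List.sum_map_mul_left]
  congr 1
  refine List.map_congr_left fun l hl => ?_
  rw [sum_boundedTypes_eq, ← List.sum_map_mul_left]
  congr 1
  refine List.map_congr_left fun l' hl' => ?_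
  rw [cast_classCard hl, cast_classCard hl']
  split_ifs
  · ring
  · ring

theorem pairCount_le (k n : ℕ) : (pairCount false k n : ℝ) ≤ (n ! : ℝ) ^ 2 * decompProb k n := by
  classical
  rw [factorial_sq_mul_decompProb, pairCount, Nat.cast_list_sum, List.map_map]
  refine List.sum_le_sum fun l hl => ?_
  rw [comp_apply, Nat.cast_list_sum, List.map_map]
  refine List.sum_le_sum fun l' hl' => ?_
  rw [comp_apply]
  split_ifs with h1 h2 h2
  · push_cast; exact le_rfl
  · exact absurd (searchDecomp_sound (by rw [length_of_mem_countLists hl,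
      length_of_mem_countLists hl']) h1) h2
  · push_cast; positivity
  · simp

theorem le_pairCount (k n : ℕ) : (n ! : ℝ) ^ 2 * decompProb k n ≤ pairCount true k n := by
  classical
  rw [factorial_sq_mul_decompProb, pairCount, Nat.cast_list_sum, List.map_map]
  refine List.sum_le_sum fun l hl => ?_
  rw [comp_apply, Nat.cast_list_sum, List.map_map]
  refine List.sum_le_sum fun l' hl' => ?_
  rw [comp_apply]
  split_ifs with h1 h2 h2
  · push_cast; exact le_rfl
  · exact absurd (searchDecomp_complete _ (by rw [length_of_mem_countLists hl,
      length_of_mem_countLists hl']) h1) h2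
  · push_cast; positivity
  · simp

/-! ### Numerical bounds -/

/-- The reciprocal of `blockWeight a b`. -/
def blockDen (a b : ℕ) : ℕ :=
  a ^ (Nat.lcm a b / a) * (Nat.lcm a b / a)! * (b ^ (Nat.lcm b a / b) * (Nat.lcm b a / b)!)

/-- An upper bound for `D * sizeWeight l`, with rounding up in each term. -/
def sizeWeightBound (D l : ℕ) : ℕ := ∑ p ∈ blockPairs l, (D / blockDen p.1 p.2 + 1)

/-- A lower bound for `D * ∏ (1 - sizeWeight l)` over `k < l ≤ k + m`, with rounding down in each
step. -/
def prodBound (D k : ℕ) : ℕ → ℕ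
  | 0 => D
  | m + 1 => prodBound D k m * (D - sizeWeightBound D (k + m + 1)) / D

theorem sizeWeight_le_bound {D : ℕ} (hD : 0 < D) (l : ℕ) :
    sizeWeight l ≤ sizeWeightBound D l / D := by
  have hD0 : (0 : ℝ) < D := by exact_mod_cast hD
  rw [le_div_iff₀ hD0, sizeWeight, Finset.sum_mul, sizeWeightBound, Nat.cast_sum]
  refine Finset.sum_le_sum fun p _ => ?_
  have h : blockWeight p.1 p.2 = (blockDen p.1 p.2 : ℝ)⁻¹ := by
    rw [blockWeight, blockDen, ← mul_inv]; push_cast; rfl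
  rw [h, mul_comm, ← div_eq_mul_inv, ← Nat.floor_div_eq_div (K := ℝ)]
  push_cast
  exact (Nat.lt_floor_add_one _).le

/-- Iteration of `sum_decompProb_succ_le` over the block sizes `k + 1, …, k + m`. -/
theorem prodBound_mul_sum_le {D : ℕ} (hD : 0 < D) (k m N : ℕ) :
    (prodBound D k m : ℝ) / D * ∑ n ∈ range N, decompProb (k + m) n ≤
      ∑ n ∈ range N, decompProb k n := by
  have hD0 : (0 : ℝ) < D := by exact_mod_cast hD
  induction m with
  | zero => rw [prodBound, div_self hD0.ne', one_mul, add_zero]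
  | succ m ih =>
    rw [← add_assoc]
    set S := ∑ n ∈ range N, decompProb (k + m + 1) n
    have hS0 : 0 ≤ S := Finset.sum_nonneg fun _ _ => decompProb_nonneg _ _
    have hu := sizeWeight_le_bound hD (k + m + 1)
    rcases le_total D (sizeWeightBound D (k + m + 1)) with h | h
    · -- the subtraction in `prodBound` truncates to zero
      rw [prodBound, Nat.sub_eq_zero_of_le h]
      simpa using Finset.sum_nonneg fun n (_ : n ∈ range N) => decompProb_nonneg k n
    · have h1 : (prodBound D k (m + 1) : ℝ) / D ≤
          prodBound D k m / D * (1 - sizeWeightBound D (k + m + 1) / D) := by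
        rw [prodBound]
        refine (div_le_div_of_nonneg_right Nat.cast_div_le hD0.le).trans_eq ?_
        push_cast [Nat.cast_sub h]
        field_simp
      have h2 : (1 - (sizeWeightBound D (k + m + 1) : ℝ) / D) * S ≤
          ∑ n ∈ range N, decompProb (k + m) n :=
        (mul_le_mul_of_nonneg_right (by linarith) hS0).trans (sum_decompProb_succ_le (k + m) N)
      calc _ ≤ prodBound D k m / D * (1 - sizeWeightBound D (k + m + 1) / D) * S :=
            mul_le_mul_of_nonneg_right h1 hS0
        _ = prodBound D k m / D * ((1 - sizeWeightBound D (k + m + 1) / D) * S) := by ring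
        _ ≤ prodBound D k m / D * ∑ n ∈ range N, decompProb (k + m) n :=
            mul_le_mul_of_nonneg_left h2 (by positivity)
        _ ≤ _ := ih

/-- An upper bound for `D` times the sum of `decompProb 4 n` over `n < 22`: exact values for
`n ≤ 10`, and beyond that the square of `boundedProb 4 n`. -/
def coreBound (D : ℕ) : ℕ :=
  ∑ n ∈ range 11, (D * pairCount true 4 n / n ! ^ 2 + 1) +
    ∑ n ∈ Ico 11 22, (D * boundedCount 4 n ^ 2 / n ! ^ 2 + 1)

theorem sum_range_decompProb_four_le {D : ℕ} (hD : 0 < D) :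
    ∑ n ∈ range 22, decompProb 4 n ≤ coreBound D / D := by
  have hD0 : (0 : ℝ) < D := by exact_mod_cast hD
  have hround : ∀ (n : ℕ) (x : ℝ) (c : ℕ), (n ! : ℝ) ^ 2 * x ≤ c →
      x * D ≤ ((D * c / n ! ^ 2 + 1 : ℕ) : ℝ) := by
    intro n x c h
    have h0 : (0 : ℝ) < (n ! : ℝ) ^ 2 := by positivity
    rw [← Nat.floor_div_eq_div (K := ℝ)]
    push_cast
    refine le_trans ?_ (Nat.lt_floor_add_one _).le
    rw [le_div_iff₀ h0]
    nlinarith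
  rw [le_div_iff₀ hD0, Finset.sum_mul, coreBound, Nat.cast_add, Nat.cast_sum, Nat.cast_sum,
    ← Finset.sum_range_add_sum_Ico _ (show 11 ≤ 22 by norm_num)]
  refine add_le_add (Finset.sum_le_sum fun n _ => hround n _ _ (le_pairCount 4 n))
    (Finset.sum_le_sum fun n _ => hround n _ _ ?_)
  push_cast
  rw [cast_boundedCount, mul_pow]
  exact mul_le_mul_of_nonneg_left (decompProb_le_boundedProb_sq 4 n) (by positivity)

theorem sum_Ico_decompProb_four_le (N : ℕ) :
    ∑ n ∈ Ico 22 N, decompProb 4 n ≤ 1 / 1000 := by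
  have hE : Real.exp (∑ j ∈ range 4, 2 ^ (j + 1) / ((j : ℝ) + 1)) ^ 2 ≤ 2.7182818286 ^ 22 := by
    rw [← Real.exp_nat_mul]
    -- the exponent is `2 * (2 + 2 + 8 / 3 + 4) = 64 / 3`
    calc _ ≤ Real.exp ((22 : ℕ) * 1) := by
          rw [Real.exp_le_exp]; norm_num [Finset.sum_range_succ]
      _ = Real.exp 1 ^ 22 := by rw [Real.exp_nat_mul]
      _ ≤ _ := pow_le_pow_left₀ (Real.exp_pos 1).le Real.exp_one_lt_d9.le 22
  have hgeom : ∑ n ∈ Ico 22 N, (1 / 4 : ℝ) ^ n ≤ 2 * (1 / 4) ^ 22 := by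
    refine (geom_sum_Ico_le_of_lt_one (by norm_num) (by norm_num)).trans ?_
    norm_num
  calc _ ≤ ∑ n ∈ Ico 22 N, 2.7182818286 ^ 22 * (1 / 4 : ℝ) ^ n :=
        Finset.sum_le_sum fun n _ => (decompProb_le_exp 4 n).trans
          (mul_le_mul_of_nonneg_right hE (by positivity))
    _ = 2.7182818286 ^ 22 * ∑ n ∈ Ico 22 N, (1 / 4 : ℝ) ^ n := by rw [Finset.mul_sum]
    _ ≤ 2.7182818286 ^ 22 * (2 * (1 / 4) ^ 22) := mul_le_mul_of_nonneg_left hgeom (by positivity)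
    _ ≤ _ := by norm_num

theorem sum_decompProb_four_le (N : ℕ) : ∑ n ∈ range N, decompProb 4 n ≤ 4.897 := by
  have h1 : ∑ n ∈ range N, decompProb 4 n ≤ ∑ n ∈ range (max N 22), decompProb 4 n :=
    Finset.sum_le_sum_of_subset_of_nonneg (by simp) fun _ _ _ => decompProb_nonneg _ _
  rw [← Finset.sum_range_add_sum_Ico _ (le_max_right N 22)] at h1
  have h2 := sum_range_decompProb_four_le (D := 1000000000) (by norm_num)
  have h3 := sum_Ico_decompProb_four_le (max N 22)
  have h4 : (coreBound 1000000000 : ℝ) ≤ 4896000000 := by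
    exact_mod_cast (by decide +kernel : coreBound 1000000000 ≤ 4896000000)
  push_cast at h2
  linarith

/-- The factor `0.765661` bounds the product of `1 - sizeWeight l` over `4 < l ≤ 80`, and `0.98588`
is `1` minus the weight of all larger blocks. -/
theorem sum_rhoSymm_le_const (N : ℕ) : ∑ n ∈ range N, rhoSymm n ≤ 6.49 := by
  have h1 := sum_rhoSymm_le 80 N
  have h2 := sum_sizeWeight_le (k := 80) (by norm_num) N
  have h3 := prodBound_mul_sum_le (D := 1000000000) (by norm_num) 4 76 N
  have h4 := sum_decompProb_four_le N
  have h5 : (765661000 : ℝ) ≤ prodBound 1000000000 4 76 := by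
    exact_mod_cast (by decide +kernel : 765661000 ≤ prodBound 1000000000 4 76)
  set R := ∑ n ∈ range N, rhoSymm n
  set S := ∑ n ∈ range N, decompProb 80 n
  have hR0 : 0 ≤ R := Finset.sum_nonneg fun _ _ => rhoSymm_nonneg _
  have hS0 : 0 ≤ S := Finset.sum_nonneg fun _ _ => decompProb_nonneg _ _
  have h6 : 0.765661 * S ≤ 4.897 := by
    refine le_trans (mul_le_mul_of_nonneg_right ?_ hS0) (h3.trans h4)
    rw [le_div_iff₀ (by norm_num)]
    push_cast
    linarith
  have h7 : 0.98588 * R ≤ S := by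
    refine le_trans (mul_le_mul_of_nonneg_right ?_ hR0) h1
    norm_num at h2 ⊢
    linarith
  norm_num at h6 h7 ⊢
  linarith

theorem Arho_lt : Arho < 6.5 := by
  have h : Arho ≤ 6.49 := Real.tsum_le_of_sum_range_le rhoSymm_nonneg sum_rhoSymm_le_const
  norm_num at h ⊢
  linarith

/-- A telescoping bound: `1 / x ^ 2 ≥ 1 / (x - c) - 1 / (x + 1 - c)` for `x ≥ 3` and `c = 9 / 20`,
which is close to the optimal `c = 1 / 2` for large `x`. -/
theorem le_sum_Ico_one_div_sq {m a N : ℕ} (ha : m + 3 ≤ a) (hN : a ≤ N) :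
    1 / ((a : ℝ) - m - 9 / 20) - 1 / ((N : ℝ) - m - 9 / 20) ≤
      ∑ n ∈ Ico a N, 1 / ((n : ℝ) - m) ^ 2 := by
  induction N, hN using Nat.le_induction with
  | base => simp
  | succ N hN ih =>
    rw [Finset.sum_Ico_succ_top hN]
    have hx : (3 : ℝ) ≤ (N : ℝ) - m := by
      have : ((m + 3 : ℕ) : ℝ) ≤ N := by exact_mod_cast ha.trans hN
      push_cast at this
      linarith
    have h : 1 / ((N : ℝ) - m - 9 / 20) - 1 / (((N + 1 : ℕ) : ℝ) - m - 9 / 20) ≤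
        1 / ((N : ℝ) - m) ^ 2 := by
      push_cast
      rw [show (N : ℝ) + 1 - m - 9 / 20 = ((N : ℝ) - m) + 11 / 20 by ring]
      generalize (N : ℝ) - m = x at *
      rw [div_sub_div _ _ (by linarith) (by linarith),
        div_le_div_iff₀ (by nlinarith) (by nlinarith)]
      nlinarith
    linarith

/-- The terms of degree below `T`, together with what the lower recursion `sum_rhoSymm_div_le`
derives from them for the degrees between `T` and `N`. -/
theorem sum_rhoSymm_mul_le_Arho {T N : ℕ} (hTN : T ≤ N) :
    ∑ m ∈ range T, rhoSymm m * (1 + ∑ n ∈ Ico (max T (2 * m + 1)) N, 1 / ((n : ℝ) - m) ^ 2) ≤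
      Arho := by
  refine le_trans ?_ (sum_range_rhoSymm_le_Arho N)
  rw [← Finset.sum_range_add_sum_Ico _ hTN]
  simp only [mul_add, mul_one, Finset.sum_add_distrib]
  refine add_le_add le_rfl ?_
  have hfilter : ∀ m, Ico (max T (2 * m + 1)) N = (Ico T N).filter fun n => 2 * m < n := by
    intro m
    ext n
    simp only [mem_Ico, mem_filter]
    omega
  calc _ = ∑ n ∈ Ico T N, ∑ m ∈ range T with 2 * m < n, rhoSymm m / ((n : ℝ) - m) ^ 2 := by
        simp only [hfilter, Finset.mul_sum, Finset.sum_filter, mul_ite, mul_zero,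
          mul_one_div]
        exact Finset.sum_comm (s := range T) (t := Ico T N)
    _ ≤ ∑ n ∈ Ico T N, rhoSymm n := by
        refine Finset.sum_le_sum fun n hn => (Finset.sum_le_sum_of_subset_of_nonneg ?_ ?_).trans
          (sum_rhoSymm_div_le n)
        · refine Finset.filter_subset_filter _ fun m hm => ?_
          simp only [mem_range, mem_Ico] at hm hn ⊢
          omega
        · exact fun m _ _ => div_nonneg (rhoSymm_nonneg m) (sq_nonneg _)

/-- A lower bound for `D * Arho` from the exact values of `rhoSymm m`, `m ≤ 10`. The last two terms
of the factor approximate the sum of `1 / (n - m) ^ 2` over `n ≥ max 11 (2 * m + 1)`. -/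
def lowerBound (D : ℕ) : ℕ :=
  ∑ m ∈ range 11, pairCount false m m *
    (D + D * 20 / (20 * (max 11 (2 * m + 1) - m) - 9) - D / 10000) / m ! ^ 2

theorem lowerBound_div_le_Arho (D : ℕ) (hD : 10000 ∣ D) (hD0 : 0 < D) :
    (lowerBound D : ℝ) / D ≤ Arho := by
  have hDr : (0 : ℝ) < D := by exact_mod_cast hD0
  refine le_trans ?_ (sum_rhoSymm_mul_le_Arho (T := 11) (N := 10021) (by norm_num))
  rw [div_le_iff₀ hDr, lowerBound, Nat.cast_sum, Finset.sum_mul]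
  refine Finset.sum_le_sum fun m hm => ?_
  rw [mem_range] at hm
  set a := max 11 (2 * m + 1) with ha
  have ham : m + 3 ≤ a := by omega
  have hsum := le_sum_Ico_one_div_sq ham (show a ≤ 10021 by omega)
  have h1 : 1 / (((10021 : ℕ) : ℝ) - m - 9 / 20) ≤ 1 / 10000 := by
    have : (m : ℝ) ≤ 10 := by exact_mod_cast (by omega)
    refine one_div_le_one_div_of_le (by norm_num) ?_
    push_cast
    linarith
  have h2 : ((D * 20 / (20 * (a - m) - 9) : ℕ) : ℝ) ≤ D * (1 / ((a : ℝ) - m - 9 / 20)) := by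
    refine Nat.cast_div_le.trans (le_of_eq ?_)
    rw [Nat.cast_sub (by omega), Nat.cast_mul, Nat.cast_mul, Nat.cast_sub (by omega)]
    have : (0 : ℝ) < (a : ℝ) - m - 9 / 20 := by
      have : ((m + 3 : ℕ) : ℝ) ≤ a := by exact_mod_cast ham
      push_cast at this
      linarith
    push_cast
    rw [show (20 : ℝ) * (a - m) - 9 = 20 * ((a : ℝ) - m - 9 / 20) by ring]
    field_simp
  have h3 : ((D / 10000 : ℕ) : ℝ) = D * (1 / 10000) := by
    rw [Nat.cast_div hD (by norm_num)]; push_cast; ring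
  have hle : D / 10000 ≤ D + D * 20 / (20 * (a - m) - 9) :=
    (Nat.div_le_self _ _).trans (Nat.le_add_right _ _)
  have hp := pairCount_le m m
  rw [← rhoSymm_eq_decompProb] at hp
  have hf : (0 : ℝ) < (m ! : ℝ) ^ 2 := by positivity
  refine Nat.cast_div_le.trans ?_
  push_cast [Nat.cast_sub hle]
  rw [div_le_iff₀ hf, h3]
  have hfac : (D : ℝ) + ((D * 20 / (20 * (a - m) - 9) : ℕ) : ℝ) - D * (1 / 10000) ≤
      D * (1 + ∑ n ∈ Ico a 10021, 1 / ((n : ℝ) - m) ^ 2) := by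
    have := mul_le_mul_of_nonneg_left hsum hDr.le
    have := mul_le_mul_of_nonneg_left h1 hDr.le
    linarith
  have hnn : (0 : ℝ) ≤ 1 + ∑ n ∈ Ico a 10021, 1 / ((n : ℝ) - m) ^ 2 := by positivity
  calc _ ≤ (pairCount false m m : ℝ) * (D * (1 + ∑ n ∈ Ico a 10021, 1 / ((n : ℝ) - m) ^ 2)) :=
        mul_le_mul_of_nonneg_left hfac (Nat.cast_nonneg _)
    _ ≤ (m ! : ℝ) ^ 2 * rhoSymm m * (D * (1 + ∑ n ∈ Ico a 10021, 1 / ((n : ℝ) - m) ^ 2)) :=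
        mul_le_mul_of_nonneg_right hp (mul_nonneg hDr.le hnn)
    _ = _ := by ring

theorem lt_Arho : 6.1 < Arho := by
  have h1 := lowerBound_div_le_Arho 1000000000 (by norm_num) (by norm_num)
  have h2 : (6120000000 : ℝ) ≤ lowerBound 1000000000 := by
    exact_mod_cast (by decide +kernel : 6120000000 ≤ lowerBound 1000000000)
  push_cast at h1
  rw [div_le_iff₀ (by norm_num)] at h1
  norm_num at h1 ⊢
  linarith

theorem theorem7 :
    Summable rhoSymm ∧
    Asymptotics.IsEquivalent Filter.atTop rhoSymm (fun n : ℕ => Arho / (n : ℝ) ^ 2) ∧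
    6.1 < Arho ∧ Arho < 6.5 :=
  ⟨summable_rhoSymm, isEquivalent_rhoSymm (by have := lt_Arho; norm_num at this; linarith),
    lt_Arho, Arho_lt⟩
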